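/- **Setting.** A polymatrix game $G$ with $n$ players and $m\ge 1$ pure strategies per player consists of a graph on the players and, for every edge $ij$, two $m\times m$ payoff matrices $A_{ij}$ (for $i$) and $A_{ji}$ (for $j$). For a strategy profile $s$, the pure strategy payoffs of $i$ are $p_i(s)=\sum_{j\in N(i)}A_{ij}s_j$ and the expected payoff of $i$ is $s_i\cdot p_i(s)$; all payoffs of a player in $G$ lie in $[0,1]$. The profile $s$ is an $\varepsilon$-NE if $s_i\cdot p_i(s)\ge\max p_i(s)-\varepsilon$ for all $i$. A strategy is $k$-uniform if it plays uniformly over a multiset of $k$ pure strategies. For a set $F$ of players let $G_F$ be the subgame of $G$ that keeps the edges with at least one endpoint in $F$. An OVD (one variable decomposable) constraint on $G$ assigns a number $g_F(s)$ to every $F$ and every profile $s$ such that: $g_\emptyset$ is constant; for $v\notin F$, $g_{F\cup\{v\}}(s)$ is a function $\mathrm{add}$ of $F$, $v$, the strategies of $v$ and of its neighbours outside $F$, and $g_F(s)$; and for disjoint $F_1,F_2$ without edges between them, $g_{F_1\cup F_2}(s)$ is a function $\mathrm{merge}$ of $F_1,F_2,g_{F_1}(s),g_{F_2}(s)$. Write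 $g$ for the value on $G$ itself, where $F$ is the set of all players. The constraint is linear in the payoffs, with coefficients $c_i,d_{i,l}\in\mathbb R$, if for all $F$ and $s$, $g_F(s)=\sum_i\big(c_i\,u_i+\sum_l d_{i,l}\,q_{i,l}\big)$, where $u_i$ and $q_{i,l}$ are the expected payoff of $i$ and its payoff for pure strategy $l$ in $G_F$ under $s$. **Algorithm.** Input: a nice tree decomposition of the graph with empty root bag, $\varepsilon>0$, $k\ge1$, and an OVD constraint. For a node $v$ with bag $X_v$, let $F_v$ be the set of players that occur in bags of the subtree of $v$ but not in $X_v$. From the leaves up, the algorithm computes for each node $v$ a table $C(v)$ of triples $(s,p,x)$: strategies and payoff vectors for the players in $X_v$, and a number. * Leaf: all choices of $k$-uniform strategies for $X_v$, with $p=0$ and $x=g_\emptyset$. * A node introducing $i$: every entry of the child, extended by every $k$-uniform strategy of $i$, with $p_i=0$ and $x$ unchanged. * A node forgetting $i$, with child $u$: every entry of $C(u)$ for which $h:=p_i+\sum_{j\in X_v\cap N(i)}A_{ij}s_j$ satisfies $s_i\cdot h\ge\max h-\varepsilon$. Then $s_i,p_i$ are deleted; for $j\in X_v$ the vector $p_j$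 (increased by $A_{ji}s_i$ if $j\in N(i)$) is rounded entrywise to the closest multiple of $\varepsilon/(2n)$; and $x$ is replaced by $\mathrm{add}(F_u,i,\cdot,x)$, evaluated at the strategies of $i$ and of its neighbours outside $F_u$. * A join node: every pair of entries of the two children $u_1,u_2$ with the same $s$; the payoff vectors are added, and $x=\mathrm{merge}(F_{u_1},F_{u_2},x_1,x_2)$. At every node, among entries with equal $(s,p)$ only those with the highest $x$ are kept. The algorithm returns a profile by starting from an entry of the root table, going down the tree and choosing entries of the children that generate the chosen entry, and giving each player the strategy that it has when it is forgotten (ties between generating entries are broken arbitrarily). **Theorem.** For every game and all coefficients $c,d$ (social welfare is $c_i=1$, $d=0$) there is an OVD constraint that is linear in the payoffs with these coefficients. Moreover there is an absolute constant $C$ such that the following holds for every such game $G$, every OVD constraint on $G$ that is linear in the payoffs with coefficients $c,d$, every nice tree decomposition of the graph of $G$ with empty root bag, every $\varepsilon>0$ and every integer $k\ge1$ with $k\ge 128\cdot\frac{\ln m+\ln n-\ln\varepsilon+\ln 8}{\varepsilon^2}$. Every profile returned by the algorithm is a $k$-uniform $1.5\varepsilon$-NE. For every $\varepsilon/8$-NE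 $s'$ of $G$, $k$-uniform or not, the algorithm returns a profile, and every profile $s$ that it can return satisfies $$g(s)\ \ge\ g(s')-C\Big(\sum_i\big(|c_i|+\sum_l|d_{i,l}|\big)\Big)\varepsilon .$$ -/

import Mathlib

/-! # Polymatrix games, nice tree decompositions, and the constrained dynamic program -/

noncomputable section

/-- An assignment of a real vector over the `m` pure strategies to each of the `n` players.
It is a strategy profile when every vector is a probability distribution (`IsProfile`); the zero
vector marks a player to whom no strategy is assigned. -/
abbrev Assignment (n m : ℕ) : Type := Fin n → Fin m → ℝ

/-- A polymatrix game with `n` players and `m` pure strategies per player: on every edge `ij` of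
the interaction graph, `payoff i j` is the payoff matrix of `i` (rows: strategies of `i`, columns:
strategies of `j`).  The matrices `payoff i j` with `ij` not an edge are never used. -/
structure PolymatrixGame (n m : ℕ) where
  graph : SimpleGraph (Fin n)
  payoff : Fin n → Fin n → Matrix (Fin m) (Fin m) ℝ

/-- Every player has a mixed strategy. -/
def IsProfile {n m : ℕ} (s : Assignment n m) : Prop :=
  ∀ i, s i ∈ stdSimplex ℝ (Fin m)

/-- `s` plays uniformly over a multiset of `k` pure strategies. -/
def IsKUniform {m : ℕ} (k : ℕ) (s : Fin m → ℝ) : Prop :=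
  ∃ S : Multiset (Fin m), S.card = k ∧ ∀ l, s l = (S.count l : ℝ) / (k : ℝ)

namespace PolymatrixGame

variable {n m : ℕ} (G : PolymatrixGame n m)

open Classical in
/-- The payoff vector that `i` obtains from the players in `S` under `s`: the sum of `A_ij s_j`
over the neighbours `j ∈ S` of `i`. -/
def payoffFrom (S : Finset (Fin n)) (s : Assignment n m) (i : Fin n) : Fin m → ℝ :=
  ∑ j ∈ S with G.graph.Adj i j, (G.payoff i j).mulVec (s j)

/-- The vector of pure strategy payoffs of player `i` under `s`. -/
def purePayoff (s : Assignment n m) (i : Fin n) : Fin m → ℝ :=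
  G.payoffFrom Finset.univ s i

/-- The expected payoff of player `i` under `s`. -/
def expectedPayoff (s : Assignment n m) (i : Fin n) : ℝ :=
  dotProduct (s i) (G.purePayoff s i)

/-- All payoffs that a player can obtain lie in `[0, 1]`. -/
def IsNormalised : Prop :=
  ∀ s, IsProfile s → ∀ i l, 0 ≤ G.purePayoff s i l ∧ G.purePayoff s i l ≤ 1

/-- `s` is an `ε`-Nash equilibrium: no player has regret larger than `ε`. -/
def IsApproxNE (ε : ℝ) (s : Assignment n m) : Prop :=
  IsProfile s ∧ ∀ i l, G.purePayoff s i l - ε ≤ G.expectedPayoff s i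

/-- The subgame that keeps exactly the edges with at least one endpoint in `F`. -/
def subgame (F : Finset (Fin n)) : PolymatrixGame n m where
  graph :=
    { Adj := fun i j => G.graph.Adj i j ∧ (i ∈ F ∨ j ∈ F)
      symm := ⟨fun _ _ h => ⟨h.1.symm, h.2.symm⟩⟩
      loopless := ⟨fun _ h => G.graph.irrefl h.1⟩ }
  payoff := G.payoff

/-- The linear function of the payoffs with coefficient `c i` at the expected payoff of player `i`
and coefficient `d i l` at the payoff of pure strategy `l` of player `i`.
Social welfare is the case `c = 1`, `d = 0`. -/
def linearPayoff (c : Fin n → ℝ) (d : Fin n → Fin m → ℝ) (s : Assignment n m) : ℝ :=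
  ∑ i, (c i * G.expectedPayoff s i + ∑ l, d i l * G.purePayoff s i l)

open Classical in
/-- The part of `s` that is relevant to the edges at `v` that do not lead into `F`: the strategies
of `v` and of its neighbours outside `F`; all other strategies are erased. -/
def localPart (F : Finset (Fin n)) (v : Fin n) (s : Assignment n m) : Assignment n m :=
  fun j => if j = v ∨ (G.graph.Adj v j ∧ j ∉ F) then s j else 0

end PolymatrixGame

/-- A one variable decomposable constraint on the game `G`.  `value F s` is the number that the
constraint assigns to the profile `s` in the subgame belonging to the set of players `F` (the edges
with an endpoint in `F`), and `value univ s` is the number assigned to `s` in `G` itself.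

When a player `v` is added to `F`, the new number is a function of `F`, of `v`, of the strategies
of `v` and of those of its neighbours to which it gets connected, and of the old number; when two
sets of players without edges between them are merged, the new number is a function of the two
sets and the two old numbers. -/
structure OVDConstraint {n m : ℕ} (G : PolymatrixGame n m) where
  value : Finset (Fin n) → Assignment n m → ℝ
  emptyValue : ℝ
  add : Finset (Fin n) → Fin n → Assignment n m → ℝ → ℝ
  merge : Finset (Fin n) → Finset (Fin n) → ℝ → ℝ → ℝ
  value_empty : ∀ s, IsProfile s → value ∅ s = emptyValue
  value_add : ∀ F v s, IsProfile s → v ∉ F →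
    value (insert v F) s = add F v (G.localPart F v s) (value F s)
  value_merge : ∀ F₁ F₂ s, IsProfile s → Disjoint F₁ F₂ →
    (∀ i ∈ F₁, ∀ j ∈ F₂, ¬ G.graph.Adj i j) →
    value (F₁ ∪ F₂) s = merge F₁ F₂ (value F₁ s) (value F₂ s)

/-- The constraint function is, on every subgame, the linear function of the payoffs of that
subgame with coefficients `c` and `d`. -/
def OVDConstraint.IsLinear {n m : ℕ} {G : PolymatrixGame n m} (K : OVDConstraint G)
    (c : Fin n → ℝ) (d : Fin n → Fin m → ℝ) : Prop :=
  ∀ F s, IsProfile s → K.value F s = (G.subgame F).linearPayoff c d s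

/-- Rooted binary trees with the four kinds of nodes of a nice tree decomposition: a leaf with a
given bag, a node that adds a vertex to the bag of its child, a node that removes a vertex from the
bag of its child, and a node with two children. -/
inductive NiceTree (n : ℕ) : Type
  | start (X : Finset (Fin n)) : NiceTree n
  | introduce (i : Fin n) (t : NiceTree n) : NiceTree n
  | forget (i : Fin n) (t : NiceTree n) : NiceTree n
  | join (t₁ t₂ : NiceTree n) : NiceTree n

namespace NiceTree

variable {n : ℕ}

/-- The bag of the root. -/
def bag : NiceTree n → Finset (Fin n)
  | start X => X
  | introduce i t => insert i t.bag
  | forget i t => t.bag.erase i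
  | join t₁ _ => t₁.bag

/-- The conditions that make the nodes what their names say: an introduced vertex is new, a
forgotten vertex was present, and the children of a join node have the same bag. -/
def WellFormed : NiceTree n → Prop
  | start _ => True
  | introduce i t => i ∉ t.bag ∧ t.WellFormed
  | forget i t => i ∈ t.bag ∧ t.WellFormed
  | join t₁ t₂ => t₁.bag = t₂.bag ∧ t₁.WellFormed ∧ t₂.WellFormed

/-- The union of all bags. -/
def players : NiceTree n → Finset (Fin n)
  | start X => X
  | introduce i t => insert i t.players
  | forget _ t => t.players
  | join t₁ t₂ => t₁.players ∪ t₂.players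

/-- The players that occur in the tree but not in the bag of its root. -/
def forgotten (t : NiceTree n) : Finset (Fin n) :=
  t.players \ t.bag

/-- The bag of the node with a given address.  The root has address `[]`, an only child is reached
by `false`, the two children of a join node by `false` and `true`. -/
def bagAt : NiceTree n → List Bool → Option (Finset (Fin n))
  | t, [] => some t.bag
  | introduce _ t, false :: a => t.bagAt a
  | forget _ t, false :: a => t.bagAt a
  | join t₁ _, false :: a => t₁.bagAt a
  | join _ t₂, true :: a => t₂.bagAt a
  | _, _ :: _ => none

/-- The node with address `b` is on the tree path between those with addresses `a` and `a'`: it is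
an ancestor of one of them (or equal to it), and every common ancestor is an ancestor of `b`. -/
def OnPath (a b a' : List Bool) : Prop :=
  (b <+: a ∨ b <+: a') ∧ ∀ e : List Bool, e <+: a → e <+: a' → e <+: b

/-- The tree with its bags is a nice tree decomposition of the graph `H`. -/
structure IsNiceTreeDecomposition (t : NiceTree n) (H : SimpleGraph (Fin n)) : Prop where
  wellFormed : t.WellFormed
  covers_vertices : ∀ v, ∃ a X, t.bagAt a = some X ∧ v ∈ X
  covers_edges : ∀ u v, H.Adj u v → ∃ a X, t.bagAt a = some X ∧ u ∈ X ∧ v ∈ X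
  connected : ∀ a b a' X Y Z, t.bagAt a = some X → t.bagAt b = some Y → t.bagAt a' = some Z →
    OnPath a b a' → X ∩ Z ⊆ Y

end NiceTree

/-- An entry of the dynamic programming table at a node with bag `X`: strategies and payoff vectors
for the players of `X` (and `0` for all other players), and the value of the constraint. -/
@[ext]
structure Candidate (n m : ℕ) where
  strat : Assignment n m
  pay : Assignment n m
  val : ℝ

/-- Rounding to the closest integer multiple of `δ`. -/
def roundTo (δ x : ℝ) : ℝ := δ * (round (x / δ) : ℝ)

namespace ConstrainedAlgorithm

variable {n m : ℕ} {G : PolymatrixGame n m}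

open Classical in
/-- `c` may be listed at a start node with bag `X`. -/
def StartStep (K : OVDConstraint G) (k : ℕ) (X : Finset (Fin n)) (c : Candidate n m) : Prop :=
  (∀ i, if i ∈ X then IsKUniform k (c.strat i) else c.strat i = 0) ∧
    c.pay = 0 ∧ c.val = K.emptyValue

/-- `c` is produced from `c'` when player `i` is introduced with some `k`-uniform strategy. -/
def IntroduceStep (k : ℕ) (i : Fin n) (c' c : Candidate n m) : Prop :=
  ∃ σ : Fin m → ℝ, IsKUniform k σ ∧
    c.strat = Function.update c'.strat i σ ∧ c.pay = Function.update c'.pay i 0 ∧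
    c.val = c'.val

/-- The payoff vector that the algorithm holds for player `i`, who is about to be forgotten: the
stored payoffs from the players already forgotten, plus the payoffs from the players in the new
bag `X`. -/
def heldPayoff (G : PolymatrixGame n m) (X : Finset (Fin n)) (c : Candidate n m) (i : Fin n) :
    Fin m → ℝ :=
  c.pay i + G.payoffFrom X c.strat i

/-- The test that player `i` is `ε`-happy. -/
def IsHappy (G : PolymatrixGame n m) (ε : ℝ) (X : Finset (Fin n)) (c : Candidate n m)
    (i : Fin n) : Prop :=
  ∀ l, heldPayoff G X c i l - ε ≤ dotProduct (c.strat i) (heldPayoff G X c i)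

open Classical in
/-- `c` is produced from the entry `c'` of the table of the child `t` when player `i` is forgotten:
`i` passes the test, the strategy and payoff vector of `i` are discarded, the payoff vectors of the
remaining players are updated by what they obtain from `i` and rounded to the closest multiple of
`ε / (2 n)`, and `i` is added to the value of the constraint. -/
def ForgetStep (K : OVDConstraint G) (ε : ℝ) (i : Fin n) (t : NiceTree n)
    (c' c : Candidate n m) : Prop :=
  IsHappy G ε (t.bag.erase i) c' i ∧
    c.strat = Function.update c'.strat i 0 ∧
    c.pay = (fun j l => if j ∈ t.bag.erase i then
      roundTo (ε / (2 * n)) (c'.pay j l + G.payoffFrom {i} c'.strat j l) else 0) ∧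
    c.val = K.add t.forgotten i (G.localPart t.forgotten i c'.strat) c'.val

/-- `c` is produced at a join node with children `t₁` and `t₂` from the entries `c₁` and `c₂` of
their tables. -/
def JoinStep (K : OVDConstraint G) (t₁ t₂ : NiceTree n) (c₁ c₂ c : Candidate n m) : Prop :=
  c₁.strat = c₂.strat ∧ c.strat = c₁.strat ∧ c.pay = c₁.pay + c₂.pay ∧
    c.val = K.merge t₁.forgotten t₂.forgotten c₁.val c₂.val

/-- Among candidates that agree on strategies and payoff vectors, keep the one with the highest
value of the constraint. -/
def keepBest (D : Set (Candidate n m)) : Set (Candidate n m) :=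
  {c ∈ D | ∀ c' ∈ D, c'.strat = c.strat → c'.pay = c.pay → c'.val ≤ c.val}

/-- First phase: the table computed at the root of the tree. -/
def table (K : OVDConstraint G) (ε : ℝ) (k : ℕ) : NiceTree n → Set (Candidate n m)
  | .start X => keepBest {c | StartStep K k X c}
  | .introduce i t => keepBest {c | ∃ c' ∈ table K ε k t, IntroduceStep k i c' c}
  | .forget i t => keepBest {c | ∃ c' ∈ table K ε k t, ForgetStep K ε i t c' c}
  | .join t₁ t₂ => keepBest {c | ∃ c₁ ∈ table K ε k t₁, ∃ c₂ ∈ table K ε k t₂,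
      JoinStep K t₁ t₂ c₁ c₂ c}

open Classical in
/-- Second phase: `s` is an assignment of strategies to the forgotten players of the tree that can
result from unrolling the entry `c` of the table at its root, by finding at every node entries of
the tables of the children from which the chosen entry was produced. -/
def Unrolls (K : OVDConstraint G) (ε : ℝ) (k : ℕ) :
    NiceTree n → Candidate n m → Assignment n m → Prop
  | .start _, _, s => s = 0
  | .introduce i t, c, s => ∃ c' ∈ table K ε k t, IntroduceStep k i c' c ∧ Unrolls K ε k t c' s
  | .forget i t, c, s => ∃ c' ∈ table K ε k t, ForgetStep K ε i t c' c ∧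
      ∃ s', Unrolls K ε k t c' s' ∧ s = Function.update s' i (c'.strat i)
  | .join t₁ t₂, c, s => ∃ c₁ ∈ table K ε k t₁, ∃ c₂ ∈ table K ε k t₂, JoinStep K t₁ t₂ c₁ c₂ c ∧
      ∃ s₁ s₂, Unrolls K ε k t₁ c₁ s₁ ∧ Unrolls K ε k t₂ c₂ s₂ ∧
        s = fun j => if j ∈ t₁.forgotten then s₁ j else s₂ j

/-- `s` can be returned by the algorithm, run on the nice tree decomposition `t` with parameters
`ε` and `k`.  Different outputs are possible only because several entries of the tables may
generate the same entry. -/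
def Returns (K : OVDConstraint G) (ε : ℝ) (k : ℕ) (t : NiceTree n) (s : Assignment n m) : Prop :=
  ∃ c ∈ table K ε k t, Unrolls K ε k t c s

end ConstrainedAlgorithm

end

/-! The theorem combines two facts: the dynamic program loses only rounding errors, and sampling
brings every equilibrium into the range of `k`-uniform profiles.

Dynamic program. The players forgotten below a node interact with the rest of the game only through
the bag. An entry therefore needs only the strategies in the bag, the payoffs collected there from
forgotten players, and the constraint value. Each forgotten player causes at most one rounding error
of half a grid step, `ε / (4n)`. When a player is tested, each coordinate of its payoff vector is
off by at most `ε / 4`, hence its regret by at most `ε / 2`. Passing the test thus bounds the true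
regret by `3ε / 2` (`table_sound`), and a `k`-uniform `ε / 2`-equilibrium passes every test
(`table_complete`).

Keeping only the best entry for each key is harmless for a linear constraint. Payoffs are sums over
edges, so adding a player shifts the value by an amount that depends only on strategies still stored
in the entry, and merging adds values. Both operations preserve the order of the values.

Sampling. Averaging `k` independent pure profiles drawn from an `ε / 8`-equilibrium moves every pure
payoff by at most `ε / 8` and every expected payoff by at most `ε / 4`, by Hoeffding and a union
bound (`exists_isKUniform_close`). The regret becomes at most `ε/8 + ε/8 + ε/4 = ε/2`, so the
sampled profile is tracked by the table. At the root all entries have the same key, so the returned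
value is at least that of the sampled profile. The only loss in the constraint comes from sampling.
-/

noncomputable section

/-! ### Tree decompositions in recursive form -/

namespace NiceTree

variable {n : ℕ}

lemma bag_subset_players {t : NiceTree n} (h : t.WellFormed) : t.bag ⊆ t.players := by
  induction t with
  | start X => exact subset_rfl
  | introduce i t ih => exact Finset.insert_subset_insert _ (ih h.2)
  | forget i t ih => exact (Finset.erase_subset _ _).trans (ih h.2)
  | join t₁ t₂ ih₁ ih₂ => exact (ih₁ h.2.1).trans Finset.subset_union_left

lemma mem_players_iff {t : NiceTree n} (h : t.WellFormed) {v : Fin n} :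
    v ∈ t.players ↔ ∃ a X, t.bagAt a = some X ∧ v ∈ X := by
  induction t with
  | start X =>
    constructor
    · exact fun hv => ⟨[], X, rfl, hv⟩
    · rintro ⟨_ | ⟨b, a⟩, Y, hY, hv⟩
      · cases hY; exact hv
      · simp [bagAt] at hY
  | introduce i t ih =>
    constructor
    · intro hv
      rcases Finset.mem_insert.1 hv with rfl | hv
      · exact ⟨[], _, rfl, Finset.mem_insert_self _ _⟩
      · obtain ⟨a, X, ha, hX⟩ := (ih h.2).1 hv
        exact ⟨false :: a, X, ha, hX⟩
    · rintro ⟨_ | ⟨_ | _, a⟩, Y, hY, hv⟩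
      · cases hY; exact bag_subset_players h hv
      · exact Finset.mem_insert_of_mem ((ih h.2).2 ⟨a, Y, hY, hv⟩)
      · cases hY
  | forget i t ih =>
    constructor
    · intro hv
      obtain ⟨a, X, ha, hX⟩ := (ih h.2).1 hv
      exact ⟨false :: a, X, ha, hX⟩
    · rintro ⟨_ | ⟨_ | _, a⟩, Y, hY, hv⟩
      · cases hY; exact bag_subset_players h hv
      · exact (ih h.2).2 ⟨a, Y, hY, hv⟩
      · cases hY
  | join t₁ t₂ ih₁ ih₂ =>
    constructor
    · intro hv
      rcases Finset.mem_union.1 hv with hv | hv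
      · obtain ⟨a, X, ha, hX⟩ := (ih₁ h.2.1).1 hv
        exact ⟨false :: a, X, ha, hX⟩
      · obtain ⟨a, X, ha, hX⟩ := (ih₂ h.2.2).1 hv
        exact ⟨true :: a, X, ha, hX⟩
    · rintro ⟨_ | ⟨_ | _, a⟩, Y, hY, hv⟩
      · cases hY; exact bag_subset_players h hv
      · exact Finset.mem_union_left _ ((ih₁ h.2.1).2 ⟨a, Y, hY, hv⟩)
      · exact Finset.mem_union_right _ ((ih₂ h.2.2).2 ⟨a, Y, hY, hv⟩)

/-- The structural consequences of being (a subtree of) a nice tree decomposition of `H`, in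
recursive form: introduced players are new, the neighbours of a forgotten player have been seen
below, and the two sides of a join share only the players of the bag. -/
def Coherent (H : SimpleGraph (Fin n)) : NiceTree n → Prop
  | start _ => True
  | introduce i t => i ∉ t.players ∧ t.Coherent H
  | forget i t => i ∈ t.bag ∧
      (∀ u ∈ (forget i t).forgotten, ∀ v, H.Adj u v → v ∈ t.players) ∧ t.Coherent H
  | join t₁ t₂ => t₁.bag = t₂.bag ∧ t₁.players ∩ t₂.players ⊆ t₁.bag ∧
      t₁.Coherent H ∧ t₂.Coherent H

lemma bagAt_nil (t : NiceTree n) : t.bagAt [] = some t.bag := by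
  cases t <;> rfl

/-- The two addresses branch right after `r`, so a common prefix reaching beyond `r` would have to
continue with both `x` and `y`. This places a join node on the path between its two subtrees. -/
lemma prefix_of_prefix_append_cons {r e a a' : List Bool} {x y : Bool} (hxy : x ≠ y)
    (h₁ : e <+: r ++ x :: a) (h₂ : e <+: r ++ y :: a') : e <+: r := by
  rcases List.prefix_or_prefix_of_prefix h₁ (List.prefix_append r _) with h | ⟨e', rfl⟩
  · exact h
  · rw [List.prefix_append_right_inj] at h₁ h₂
    rcases e' with _ | ⟨z, e'⟩
    · simp
    · rw [List.cons_prefix_cons] at h₁ h₂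
      exact absurd (h₁.1.symm.trans h₂.1) hxy

/-- Conditions on addresses in the whole tree do not restrict to subtrees: an edge may be covered
elsewhere. Hence `T` stays fixed and the induction runs over the subtree `t` sitting at address `r`.
In each case a player violating coherence would occur on both sides of some node without being in
its bag. -/
lemma IsNiceTreeDecomposition.coherent_of_bagAt {T : NiceTree n} {H : SimpleGraph (Fin n)}
    (hT : T.IsNiceTreeDecomposition H) (t : NiceTree n) (ht : t.WellFormed) (r : List Bool)
    (hr : ∀ a, T.bagAt (r ++ a) = t.bagAt a) : t.Coherent H := by
  induction t generalizing r with
  | start X => trivial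
  | introduce i t ih =>
    have hr' : ∀ a, T.bagAt (r ++ [false] ++ a) = t.bagAt a := fun a => by
      rw [List.append_assoc]; exact hr _
    refine ⟨fun hi => ht.1 ?_, ih ht.2 _ hr'⟩
    obtain ⟨a, X, ha, hX⟩ := (mem_players_iff ht.2).1 hi
    refine hT.connected r (r ++ [false]) (r ++ [false] ++ a) (insert i t.bag) t.bag X
      (by simpa [bagAt, bag] using hr []) (by simpa [bagAt_nil] using hr' []) (by rw [hr', ha])
      ⟨Or.inr (List.prefix_append _ _), fun e he _ => he.trans (List.prefix_append _ _)⟩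
      (Finset.mem_inter.2 ⟨Finset.mem_insert_self _ _, hX⟩)
  | forget i t ih =>
    have hr' : ∀ a, T.bagAt (r ++ [false] ++ a) = t.bagAt a := fun a => by
      rw [List.append_assoc]; exact hr _
    refine ⟨ht.1, fun u hu v huv => ?_, ih ht.2 _ hr'⟩
    obtain ⟨hu₁, hu₂⟩ := Finset.mem_sdiff.1 hu
    obtain ⟨a, X, ha, hX⟩ := (mem_players_iff (t := forget i t) ht).1 hu₁
    obtain ⟨b, Y, hb, huY, hvY⟩ := hT.covers_edges u v huv
    by_cases hrb : r <+: b
    · obtain ⟨b, rfl⟩ := hrb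
      rw [hr] at hb
      exact (mem_players_iff (t := forget i t) ht).2 ⟨b, Y, hb, hvY⟩
    -- The edge is covered outside the subtree at `r`, while `u` also occurs inside it. The path
    -- between the two nodes passes through `r`, so `u` would still be in the bag there.
    · refine absurd (hT.connected b r (r ++ a) Y (forget i t).bag X hb
        (by simpa [bagAt_nil] using hr []) (by rw [hr, ha])
        ⟨Or.inr (List.prefix_append _ _), fun e he he' => ?_⟩
        (Finset.mem_inter.2 ⟨huY, hX⟩)) hu₂
      rcases List.prefix_or_prefix_of_prefix he' (List.prefix_append r _) with h | h
      · exact h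
      · exact absurd (h.trans he) hrb
  | join t₁ t₂ ih₁ ih₂ =>
    have hr₁ : ∀ a, T.bagAt (r ++ [false] ++ a) = t₁.bagAt a := fun a => by
      rw [List.append_assoc]; exact hr _
    have hr₂ : ∀ a, T.bagAt (r ++ [true] ++ a) = t₂.bagAt a := fun a => by
      rw [List.append_assoc]; exact hr _
    refine ⟨ht.1, fun v hv => ?_, ih₁ ht.2.1 _ hr₁, ih₂ ht.2.2 _ hr₂⟩
    obtain ⟨hv₁, hv₂⟩ := Finset.mem_inter.1 hv
    obtain ⟨a₁, X₁, ha₁, hX₁⟩ := (mem_players_iff ht.2.1).1 hv₁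
    obtain ⟨a₂, X₂, ha₂, hX₂⟩ := (mem_players_iff ht.2.2).1 hv₂
    refine hT.connected (r ++ false :: a₁) r (r ++ true :: a₂) X₁ t₁.bag X₂
      (by rw [hr]; exact ha₁) (by simpa [bagAt, bag] using hr []) (by rw [hr]; exact ha₂)
      ⟨Or.inl (List.prefix_append _ _), fun e he he' => ?_⟩ (Finset.mem_inter.2 ⟨hX₁, hX₂⟩)
    exact prefix_of_prefix_append_cons (by decide) he he'

lemma IsNiceTreeDecomposition.coherent {t : NiceTree n} {H : SimpleGraph (Fin n)}
    (ht : t.IsNiceTreeDecomposition H) : t.Coherent H :=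
  ht.coherent_of_bagAt t ht.wellFormed [] fun _ => rfl

lemma IsNiceTreeDecomposition.players_eq {t : NiceTree n} {H : SimpleGraph (Fin n)}
    (ht : t.IsNiceTreeDecomposition H) : t.players = Finset.univ :=
  Finset.eq_univ_of_forall fun v => (mem_players_iff ht.wellFormed).2 (ht.covers_vertices v)

lemma Coherent.bag_subset_players {H : SimpleGraph (Fin n)} {t : NiceTree n}
    (h : t.Coherent H) : t.bag ⊆ t.players := by
  induction t with
  | start X => exact subset_rfl
  | introduce i t ih => exact Finset.insert_subset_insert _ (ih h.2)
  | forget i t ih => exact (Finset.erase_subset _ _).trans (ih h.2.2)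
  | join t₁ t₂ ih₁ ih₂ => exact (ih₁ h.2.2.1).trans Finset.subset_union_left

lemma disjoint_forgotten_bag (t : NiceTree n) : Disjoint t.forgotten t.bag :=
  Finset.sdiff_disjoint

lemma forgotten_start (X : Finset (Fin n)) : (start X).forgotten = ∅ :=
  Finset.sdiff_self X

lemma forgotten_introduce {i : Fin n} {t : NiceTree n} (h : i ∉ t.players) :
    (introduce i t).forgotten = t.forgotten := by
  ext v
  simp only [forgotten, players, bag, Finset.mem_sdiff, Finset.mem_insert]
  grind

lemma forgotten_forget {i : Fin n} {t : NiceTree n} (h : i ∈ t.players) :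
    (forget i t).forgotten = insert i t.forgotten := by
  ext v
  simp only [forgotten, players, bag, Finset.mem_sdiff, Finset.mem_insert, Finset.mem_erase]
  grind

lemma forgotten_join {t₁ t₂ : NiceTree n} (h : t₁.bag = t₂.bag) :
    (join t₁ t₂).forgotten = t₁.forgotten ∪ t₂.forgotten := by
  simp only [forgotten, players, bag, ← h]
  exact Finset.union_sdiff_distrib _ _ _

lemma disjoint_forgotten {t₁ t₂ : NiceTree n} (h : t₁.players ∩ t₂.players ⊆ t₁.bag) :
    Disjoint t₁.forgotten t₂.forgotten := by
  refine Finset.disjoint_left.2 fun v h₁ h₂ => ?_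
  obtain ⟨h₁, h₁'⟩ := Finset.mem_sdiff.1 h₁
  exact h₁' (h (Finset.mem_inter.2 ⟨h₁, (Finset.mem_sdiff.1 h₂).1⟩))

lemma Coherent.mem_players_of_adj {H : SimpleGraph (Fin n)} {t : NiceTree n} (h : t.Coherent H)
    {u v : Fin n} (hu : u ∈ t.forgotten) (huv : H.Adj u v) : v ∈ t.players := by
  induction t with
  | start X => simp [forgotten_start] at hu
  | introduce i t ih =>
    rw [forgotten_introduce h.1] at hu
    exact Finset.mem_insert_of_mem (ih h.2 hu)
  | forget i t ih => exact h.2.1 u hu v huv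
  | join t₁ t₂ ih₁ ih₂ =>
    rw [forgotten_join h.1] at hu
    rcases Finset.mem_union.1 hu with hu | hu
    · exact Finset.mem_union_left _ (ih₁ h.2.2.1 hu)
    · exact Finset.mem_union_right _ (ih₂ h.2.2.2 hu)

/-- An edge would put `v` among the players of both sides, hence into the common bag, although `v`
is already forgotten. -/
lemma Coherent.not_adj_join {H : SimpleGraph (Fin n)} {t₁ t₂ : NiceTree n}
    (h : (join t₁ t₂).Coherent H) {u v : Fin n} (hu : u ∈ t₁.forgotten)
    (hv : v ∈ t₂.forgotten) : ¬ H.Adj u v := fun huv => by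
  have h₁ := h.2.2.1.mem_players_of_adj hu huv
  obtain ⟨h₂, h₂'⟩ := Finset.mem_sdiff.1 hv
  exact h₂' (h.1 ▸ h.2.1 (Finset.mem_inter.2 ⟨h₁, h₂⟩))

end NiceTree
end

noncomputable section

/-! ### Linear functions of the payoffs are additive over edges -/

namespace PolymatrixGame

variable {n m : ℕ} (G : PolymatrixGame n m)

/-- The game with the payoff matrices of `G` on another interaction graph. -/
def withGraph (H : SimpleGraph (Fin n)) : PolymatrixGame n m where
  graph := H
  payoff := G.payoff

/-- The edges at `v` that do not lead into `F`. -/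
def star (F : Finset (Fin n)) (v : Fin n) : SimpleGraph (Fin n) where
  Adj i j := G.graph.Adj i j ∧ (i = v ∧ j ∉ F ∨ j = v ∧ i ∉ F)
  symm := ⟨fun _ _ h => ⟨h.1.symm, h.2.symm⟩⟩
  loopless := ⟨fun _ h => G.graph.irrefl h.1⟩

/-- `H` is the disjoint union of the edge sets of `H₁` and `H₂`. -/
def IsEdgePartition (H H₁ H₂ : SimpleGraph (Fin n)) : Prop :=
  ∀ i j, (H.Adj i j ↔ H₁.Adj i j ∨ H₂.Adj i j) ∧ ¬ (H₁.Adj i j ∧ H₂.Adj i j)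

lemma payoffFrom_congr {S : Finset (Fin n)} {s s' : Assignment n m} {i : Fin n}
    (h : ∀ j ∈ S, G.graph.Adj i j → s j = s' j) :
    G.payoffFrom S s i = G.payoffFrom S s' i := by
  classical
  unfold payoffFrom
  refine Finset.sum_congr rfl fun j hj => ?_
  rw [Finset.mem_filter] at hj
  rw [h j hj.1 hj.2]

lemma payoffFrom_union {S T : Finset (Fin n)} (h : Disjoint S T) (s : Assignment n m)
    (i : Fin n) : G.payoffFrom (S ∪ T) s i = G.payoffFrom S s i + G.payoffFrom T s i := by
  classical
  unfold payoffFrom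
  rw [Finset.filter_union, Finset.sum_union]
  exact Finset.disjoint_filter_filter h

lemma payoffFrom_insert {S : Finset (Fin n)} {v : Fin n} (h : v ∉ S) (s : Assignment n m)
    (i : Fin n) : G.payoffFrom (insert v S) s i = G.payoffFrom S s i + G.payoffFrom {v} s i := by
  rw [Finset.insert_eq, Finset.union_comm,
    payoffFrom_union _ (Finset.disjoint_singleton_right.2 h)]

lemma payoffFrom_eq_zero {S : Finset (Fin n)} {s : Assignment n m} {i : Fin n}
    (h : ∀ j ∈ S, ¬ G.graph.Adj i j) : G.payoffFrom S s i = 0 := by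
  classical
  unfold payoffFrom
  rw [Finset.filter_false_of_mem h, Finset.sum_empty]

lemma purePayoff_eq_payoffFrom {S : Finset (Fin n)} {s : Assignment n m} {i : Fin n}
    (h : ∀ j, G.graph.Adj i j → j ∈ S) : G.purePayoff s i = G.payoffFrom S s i := by
  classical
  rw [purePayoff, ← Finset.union_compl S, payoffFrom_union _ disjoint_compl_right,
    payoffFrom_eq_zero (S := Sᶜ), add_zero]
  exact fun j hj hij => Finset.mem_compl.1 hj (h j hij)

lemma purePayoff_withGraph {H H₁ H₂ : SimpleGraph (Fin n)} (h : IsEdgePartition H H₁ H₂)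
    (s : Assignment n m) (i : Fin n) :
    (G.withGraph H).purePayoff s i =
      (G.withGraph H₁).purePayoff s i + (G.withGraph H₂).purePayoff s i := by
  classical
  unfold purePayoff payoffFrom withGraph
  rw [Finset.sum_filter, Finset.sum_filter, Finset.sum_filter, ← Finset.sum_add_distrib]
  refine Finset.sum_congr rfl fun j _ => ?_
  have := h i j
  by_cases h₁ : H₁.Adj i j <;> by_cases h₂ : H₂.Adj i j <;> simp_all

lemma linearPayoff_withGraph {H H₁ H₂ : SimpleGraph (Fin n)} (h : IsEdgePartition H H₁ H₂)
    (c : Fin n → ℝ) (d : Fin n → Fin m → ℝ) (s : Assignment n m) :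
    (G.withGraph H).linearPayoff c d s =
      (G.withGraph H₁).linearPayoff c d s + (G.withGraph H₂).linearPayoff c d s := by
  simp only [linearPayoff, expectedPayoff, G.purePayoff_withGraph h, ← Finset.sum_add_distrib,
    dotProduct_add, Pi.add_apply, mul_add]
  refine Finset.sum_congr rfl fun j _ => ?_
  rw [Finset.sum_add_distrib]
  ring

lemma linearPayoff_congr (c : Fin n → ℝ) (d : Fin n → Fin m → ℝ) {s s' : Assignment n m}
    (h : ∀ i j, G.graph.Adj i j → s i = s' i) :
    G.linearPayoff c d s = G.linearPayoff c d s' := by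
  have key : ∀ i, G.purePayoff s i = G.purePayoff s' i := fun i =>
    G.payoffFrom_congr fun j _ hij => h j i hij.symm
  unfold linearPayoff expectedPayoff
  refine Finset.sum_congr rfl fun i _ => ?_
  rw [key]
  -- A player without edges has zero payoffs, so its strategy is irrelevant even if it differs.
  by_cases hi : ∃ j, G.graph.Adj i j
  · obtain ⟨j, hij⟩ := hi
    rw [h i j hij]
  · have : G.purePayoff s' i = 0 := G.payoffFrom_eq_zero fun j _ hij => hi ⟨j, hij⟩
    simp [this]

lemma isEdgePartition_insert {F : Finset (Fin n)} {v : Fin n} (hv : v ∉ F) :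
    IsEdgePartition (G.subgame (insert v F)).graph (G.subgame F).graph (G.star F v) := by
  intro i j
  simp only [subgame, star, Finset.mem_insert]
  grind

lemma isEdgePartition_union {F₁ F₂ : Finset (Fin n)} (h : Disjoint F₁ F₂)
    (hadj : ∀ i ∈ F₁, ∀ j ∈ F₂, ¬ G.graph.Adj i j) :
    IsEdgePartition (G.subgame (F₁ ∪ F₂)).graph (G.subgame F₁).graph (G.subgame F₂).graph := by
  intro i j
  have h₁ := hadj i
  have h₂ := hadj j
  have h₃ := G.graph.adj_comm i j
  have h₄ := Finset.disjoint_left.1 h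
  simp only [subgame, Finset.mem_union]
  grind

/-- The edges gained are exactly the star at `v`, and all their endpoints have strategies recorded
in the local part. The increment is therefore independent of everything erased by `localPart`. -/
lemma linearPayoff_insert {F : Finset (Fin n)} {v : Fin n} (hv : v ∉ F)
    (c : Fin n → ℝ) (d : Fin n → Fin m → ℝ) (s : Assignment n m) :
    (G.subgame (insert v F)).linearPayoff c d s = (G.subgame F).linearPayoff c d s +
      (G.withGraph (G.star F v)).linearPayoff c d (G.localPart F v s) := by
  classical
  have h₁ := G.linearPayoff_withGraph (G.isEdgePartition_insert hv) c d s
  have h₂ : (G.withGraph (G.star F v)).linearPayoff c d (G.localPart F v s) =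
      (G.withGraph (G.star F v)).linearPayoff c d s := by
    refine linearPayoff_congr _ c d fun i j hij => if_pos ?_
    rcases hij with ⟨hij, ⟨rfl, _⟩ | ⟨rfl, h⟩⟩
    · exact Or.inl rfl
    · exact Or.inr ⟨hij.symm, h⟩
  rw [h₂]
  exact h₁

lemma linearPayoff_union {F₁ F₂ : Finset (Fin n)} (h : Disjoint F₁ F₂)
    (hadj : ∀ i ∈ F₁, ∀ j ∈ F₂, ¬ G.graph.Adj i j)
    (c : Fin n → ℝ) (d : Fin n → Fin m → ℝ) (s : Assignment n m) :
    (G.subgame (F₁ ∪ F₂)).linearPayoff c d s =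
      (G.subgame F₁).linearPayoff c d s + (G.subgame F₂).linearPayoff c d s :=
  G.linearPayoff_withGraph (G.isEdgePartition_union h hadj) c d s

lemma linearPayoff_subgame_empty (c : Fin n → ℝ) (d : Fin n → Fin m → ℝ) (s : Assignment n m) :
    (G.subgame ∅).linearPayoff c d s = 0 := by
  have : ∀ i, (G.subgame ∅).purePayoff s i = 0 := fun i =>
    payoffFrom_eq_zero _ fun j _ hij => by simp [subgame] at hij
  simp [linearPayoff, expectedPayoff, this]

lemma subgame_univ : G.subgame Finset.univ = G := by
  cases G
  simp [subgame]

end PolymatrixGame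

/-- The constraint given by a linear function of the payoffs. -/
def OVDConstraint.linear {n m : ℕ} (G : PolymatrixGame n m) (c : Fin n → ℝ)
    (d : Fin n → Fin m → ℝ) : OVDConstraint G where
  value F s := (G.subgame F).linearPayoff c d s
  emptyValue := 0
  add F v s x := x + (G.withGraph (G.star F v)).linearPayoff c d s
  merge _ _ x₁ x₂ := x₁ + x₂
  value_empty s _ := G.linearPayoff_subgame_empty c d s
  value_add _ _ s _ hv := G.linearPayoff_insert hv c d s
  value_merge _ _ s _ h hadj := G.linearPayoff_union h hadj c d s

lemma OVDConstraint.linear_isLinear {n m : ℕ} (G : PolymatrixGame n m) (c : Fin n → ℝ)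
    (d : Fin n → Fin m → ℝ) : (OVDConstraint.linear G c d).IsLinear c d :=
  fun _ _ _ => rfl

end

noncomputable section

/-! ### Elementary estimates and monotonicity of linear constraints -/

lemma IsKUniform.mem_stdSimplex {m k : ℕ} (hk : 0 < k) {σ : Fin m → ℝ} (h : IsKUniform k σ) :
    σ ∈ stdSimplex ℝ (Fin m) := by
  obtain ⟨S, hS, hσ⟩ := h
  refine ⟨fun l => by rw [hσ]; positivity, ?_⟩
  have hk' : (k : ℝ) ≠ 0 := by positivity
  simp_rw [hσ, ← Finset.sum_div]
  rw [div_eq_one_iff_eq hk', ← hS, ← Nat.cast_sum]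
  simp [Multiset.sum_count_eq_card]

lemma finite_setOf_isKUniform (m k : ℕ) : {σ : Fin m → ℝ | IsKUniform k σ}.Finite := by
  refine (Set.finite_range fun (S : Sym (Fin m) k) (l : Fin m) =>
    ((S : Multiset (Fin m)).count l : ℝ) / (k : ℝ)).subset ?_
  rintro σ ⟨S, hS, hσ⟩
  exact ⟨⟨S, hS⟩, funext fun l => (hσ l).symm⟩

lemma abs_roundTo_sub_le {δ : ℝ} (hδ : 0 < δ) (x : ℝ) : |roundTo δ x - x| ≤ δ / 2 := by
  have h : roundTo δ x - x = δ * -(x / δ - (round (x / δ) : ℝ)) := by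
    unfold roundTo
    field_simp
    ring
  rw [h, abs_mul, abs_neg, abs_of_pos hδ]
  nlinarith [abs_sub_round (x / δ)]

lemma abs_dotProduct_sub_le {m : ℕ} {σ p q : Fin m → ℝ} (hσ : σ ∈ stdSimplex ℝ (Fin m)) {η : ℝ}
    (h : ∀ l, |p l - q l| ≤ η) : |dotProduct σ p - dotProduct σ q| ≤ η := by
  rw [← dotProduct_sub]
  calc |dotProduct σ (p - q)| ≤ ∑ l, |σ l * (p - q) l| := Finset.abs_sum_le_sum_abs _ _
    _ ≤ ∑ l, σ l * η := Finset.sum_le_sum fun l _ => by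
        rw [abs_mul, abs_of_nonneg (hσ.1 l)]
        exact mul_le_mul_of_nonneg_left (h l) (hσ.1 l)
    _ = η := by rw [← Finset.sum_mul, hσ.2, one_mul]

namespace OVDConstraint

variable {n m : ℕ} {G : PolymatrixGame n m} {K : OVDConstraint G} {c : Fin n → ℝ}
  {d : Fin n → Fin m → ℝ}

/-- Equal local parts give equal increments. This is what justifies discarding inferior entries when
a player is forgotten. -/
lemma IsLinear.value_insert_mono (hK : K.IsLinear c d) {F : Finset (Fin n)} {v : Fin n}
    (hv : v ∉ F) {s s' : Assignment n m} (hs : IsProfile s) (hs' : IsProfile s')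
    (hloc : G.localPart F v s = G.localPart F v s') (h : K.value F s ≤ K.value F s') :
    K.value (insert v F) s ≤ K.value (insert v F) s' := by
  rw [hK _ _ hs, hK _ _ hs'] at h ⊢
  rw [G.linearPayoff_insert hv, G.linearPayoff_insert hv, hloc]
  linarith

lemma IsLinear.value_union (hK : K.IsLinear c d) {F₁ F₂ : Finset (Fin n)} {s : Assignment n m}
    (hs : IsProfile s) (h : Disjoint F₁ F₂) (hadj : ∀ i ∈ F₁, ∀ j ∈ F₂, ¬ G.graph.Adj i j) :
    K.value (F₁ ∪ F₂) s = K.value F₁ s + K.value F₂ s := by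
  rw [hK _ _ hs, hK _ _ hs, hK _ _ hs]
  exact G.linearPayoff_union h hadj c d s

lemma IsLinear.value_congr (hK : K.IsLinear c d) {F : Finset (Fin n)} {s s' : Assignment n m}
    (hs : IsProfile s) (hs' : IsProfile s')
    (h : ∀ i, (i ∈ F ∨ ∃ j ∈ F, G.graph.Adj j i) → s i = s' i) :
    K.value F s = K.value F s' := by
  rw [hK _ _ hs, hK _ _ hs']
  refine PolymatrixGame.linearPayoff_congr _ c d fun i j hij => h i ?_
  rcases hij with ⟨hij, hi | hj⟩
  · exact Or.inl hi
  · exact Or.inr ⟨j, hj, hij.symm⟩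

end OVDConstraint

/-! ### Rounding errors in the stored payoffs -/

namespace ConstrainedAlgorithm

variable {n m : ℕ} {G : PolymatrixGame n m} {K : OVDConstraint G} {ε : ℝ} {k : ℕ}

/-- The vectors `p` approximate what the players of `X` obtain from `F` under `s`, up to one
rounding error for every player of `F`. -/
def ApproxPay (G : PolymatrixGame n m) (ε : ℝ) (F X : Finset (Fin n)) (s p : Assignment n m) :
    Prop :=
  ∀ j ∈ X, ∀ l, |p j l - G.payoffFrom F s j l| ≤ F.card * (ε / (4 * n))

/-- A new player has no forgotten neighbour, so its initial payoff `0` is exact. -/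
lemma ApproxPay.introduce (hε : 0 < ε) {F X : Finset (Fin n)} {s p : Assignment n m}
    (h : ApproxPay G ε F X s p) {i : Fin n} (hi : ∀ j ∈ F, ¬ G.graph.Adj i j) :
    ApproxPay G ε F (insert i X) s (Function.update p i 0) := by
  intro j hj l
  by_cases hji : j = i
  · subst hji
    rw [G.payoffFrom_eq_zero hi]
    simp only [Function.update_self, Pi.zero_apply, sub_zero, abs_zero]
    positivity
  · rw [Function.update_of_ne hji]
    exact h j ((Finset.mem_insert.1 hj).resolve_left hji) l

lemma ApproxPay.join {F₁ F₂ X : Finset (Fin n)} {s p₁ p₂ : Assignment n m}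
    (h₁ : ApproxPay G ε F₁ X s p₁) (h₂ : ApproxPay G ε F₂ X s p₂) (hF : Disjoint F₁ F₂) :
    ApproxPay G ε (F₁ ∪ F₂) X s (p₁ + p₂) := by
  intro j hj l
  rw [G.payoffFrom_union hF, Finset.card_union_of_disjoint hF]
  have h₁ := abs_le.1 (h₁ j hj l)
  have h₂ := abs_le.1 (h₂ j hj l)
  simp only [Pi.add_apply]
  push_cast
  rw [abs_le]
  constructor <;> linarith [h₁.1, h₁.2, h₂.1, h₂.2]

open Classical in
lemma ApproxPay.forget (hε : 0 < ε) {F X : Finset (Fin n)} {s s' p : Assignment n m}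
    (h : ApproxPay G ε F X s p) {i : Fin n} (hi : i ∉ F) (hs : s' i = s i) :
    ApproxPay G ε (insert i F) (X.erase i) s (fun j l => if j ∈ X.erase i then
      roundTo (ε / (2 * n)) (p j l + G.payoffFrom {i} s' j l) else 0) := by
  intro j hj l
  have hn : (0 : ℝ) < n := by exact_mod_cast i.pos
  have hs' : G.payoffFrom {i} s' j = G.payoffFrom {i} s j :=
    G.payoffFrom_congr fun v hv _ => by rw [Finset.mem_singleton.1 hv, hs]
  rw [G.payoffFrom_insert hi, Finset.card_insert_of_notMem hi]
  simp only [if_pos hj, hs', Pi.add_apply]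
  have h₁ := abs_le.1 (h j (Finset.mem_of_mem_erase hj) l)
  have h₂ := abs_le.1 (abs_roundTo_sub_le (show 0 < ε / (2 * n) by positivity)
    (p j l + G.payoffFrom {i} s j l))
  -- Half a grid step: the error budget that the newly forgotten `i` adds to the cardinality.
  have h₃ : ε / (2 * n) / 2 = ε / (4 * n) := by field_simp; norm_num
  rw [h₃] at h₂
  push_cast
  rw [abs_le]
  constructor <;> linarith [h₁.1, h₁.2, h₂.1, h₂.2]

/-- All neighbours of `i` are forgotten or in the bag. The payoffs from the bag are computed
exactly, and those from `F` carry at most `n` errors of `ε / (4n)`. -/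
lemma abs_heldPayoff_sub_le (hε : 0 < ε) {F X : Finset (Fin n)} {s : Assignment n m}
    {c : Candidate n m} {i : Fin n} (h : ApproxPay G ε F X s c.pay) (hi : i ∈ X)
    (hFX : Disjoint F X) (hadj : ∀ j, G.graph.Adj i j → j ∈ F ∨ j ∈ X)
    (hs : ∀ j ∈ X, c.strat j = s j) (l : Fin m) :
    |heldPayoff G (X.erase i) c i l - G.purePayoff s i l| ≤ ε / 4 := by
  have hn : (0 : ℝ) < n := by exact_mod_cast i.pos
  have h₁ : G.purePayoff s i = G.payoffFrom F s i + G.payoffFrom (X.erase i) s i := by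
    rw [G.purePayoff_eq_payoffFrom (S := F ∪ X.erase i), G.payoffFrom_union]
    · exact hFX.mono_right (Finset.erase_subset _ _)
    · intro j hij
      rcases hadj j hij with hj | hj
      · exact Finset.mem_union_left _ hj
      · exact Finset.mem_union_right _ (Finset.mem_erase.2 ⟨hij.ne', hj⟩)
  have h₂ : G.payoffFrom (X.erase i) c.strat i = G.payoffFrom (X.erase i) s i :=
    G.payoffFrom_congr fun j hj _ => hs j (Finset.mem_of_mem_erase hj)
  rw [heldPayoff, h₁, h₂, Pi.add_apply, Pi.add_apply, add_sub_add_right_eq_sub]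
  refine (h i hi l).trans ?_
  have h₃ : (F.card : ℝ) ≤ n := by exact_mod_cast (Finset.card_le_univ F).trans_eq (by simp)
  calc (F.card : ℝ) * (ε / (4 * n)) ≤ n * (ε / (4 * n)) := by gcongr
    _ = ε / 4 := by field_simp

/-! ### Finiteness and shape of the tables -/

lemma exists_mem_keepBest {D : Set (Candidate n m)} (hD : D.Finite) {c : Candidate n m}
    (hc : c ∈ D) : ∃ c' ∈ keepBest D, c'.strat = c.strat ∧ c'.pay = c.pay ∧ c.val ≤ c'.val := by
  obtain ⟨c', ⟨hc', h₁, h₂⟩, hmax⟩ := Set.exists_max_image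
    {c' ∈ D | c'.strat = c.strat ∧ c'.pay = c.pay} Candidate.val (hD.subset fun _ h => h.1)
    ⟨c, hc, rfl, rfl⟩
  exact ⟨c', ⟨hc', fun e he h₃ h₄ => hmax e ⟨he, h₃.trans h₁, h₄.trans h₂⟩⟩, h₁, h₂,
    hmax c ⟨hc, rfl, rfl⟩⟩

open Classical in
lemma finite_setOf_startStep (K : OVDConstraint G) (k : ℕ) (X : Finset (Fin n)) :
    {c | StartStep K k X c}.Finite := by
  have h : {s : Assignment n m | ∀ i, s i ∈ {σ | IsKUniform k σ} ∪ {0}}.Finite :=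
    Set.Finite.pi' fun i => (finite_setOf_isKUniform m k).union (Set.finite_singleton 0)
  refine (h.image fun s => (⟨s, 0, K.emptyValue⟩ : Candidate n m)).subset ?_
  rintro c ⟨h₁, h₂, h₃⟩
  refine ⟨c.strat, fun i => ?_, Candidate.ext rfl h₂.symm h₃.symm⟩
  have := h₁ i
  split_ifs at this
  · exact Or.inl this
  · exact Or.inr this

lemma finite_setOf_introduceStep (k : ℕ) (i : Fin n) (c' : Candidate n m) :
    {c | IntroduceStep k i c' c}.Finite := by
  refine ((finite_setOf_isKUniform m k).image fun σ => (⟨Function.update c'.strat i σ,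
    Function.update c'.pay i 0, c'.val⟩ : Candidate n m)).subset ?_
  rintro c ⟨σ, hσ, h₁, h₂, h₃⟩
  exact ⟨σ, hσ, Candidate.ext h₁.symm h₂.symm h₃.symm⟩

lemma finite_setOf_forgetStep (K : OVDConstraint G) (ε : ℝ) (i : Fin n) (t : NiceTree n)
    (c' : Candidate n m) : {c | ForgetStep K ε i t c' c}.Finite :=
  Set.Subsingleton.finite fun _ h _ h' => Candidate.ext (h.2.1.trans h'.2.1.symm)
    (h.2.2.1.trans h'.2.2.1.symm) (h.2.2.2.trans h'.2.2.2.symm)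

lemma finite_setOf_joinStep (K : OVDConstraint G) (t₁ t₂ : NiceTree n)
    (c₁ c₂ : Candidate n m) : {c | JoinStep K t₁ t₂ c₁ c₂ c}.Finite :=
  Set.Subsingleton.finite fun _ h _ h' => Candidate.ext (h.2.1.trans h'.2.1.symm)
    (h.2.2.1.trans h'.2.2.1.symm) (h.2.2.2.trans h'.2.2.2.symm)

/-- The set of all entries generated at the root of the tree, before the best ones are kept. -/
def generated (K : OVDConstraint G) (ε : ℝ) (k : ℕ) : NiceTree n → Set (Candidate n m)
  | .start X => {c | StartStep K k X c}
  | .introduce i t => {c | ∃ c' ∈ table K ε k t, IntroduceStep k i c' c}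
  | .forget i t => {c | ∃ c' ∈ table K ε k t, ForgetStep K ε i t c' c}
  | .join t₁ t₂ => {c | ∃ c₁ ∈ table K ε k t₁, ∃ c₂ ∈ table K ε k t₂, JoinStep K t₁ t₂ c₁ c₂ c}

lemma table_eq_keepBest_generated (K : OVDConstraint G) (ε : ℝ) (k : ℕ) (t : NiceTree n) :
    table K ε k t = keepBest (generated K ε k t) := by
  cases t <;> rfl

lemma mem_generated_of_mem_table {t : NiceTree n} {c : Candidate n m}
    (h : c ∈ table K ε k t) : c ∈ generated K ε k t := by
  rw [table_eq_keepBest_generated] at h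
  exact h.1

lemma finite_generated (K : OVDConstraint G) (ε : ℝ) (k : ℕ) (t : NiceTree n) :
    (generated K ε k t).Finite := by
  have key : ∀ t, (generated K ε k t).Finite → (table K ε k t).Finite := fun t h =>
    h.subset fun _ => mem_generated_of_mem_table
  induction t with
  | start X => exact finite_setOf_startStep K k X
  | introduce i t ih =>
    refine ((key t ih).biUnion fun c' _ => finite_setOf_introduceStep k i c').subset ?_
    rintro c ⟨c', h, h'⟩
    exact Set.mem_biUnion h h'
  | forget i t ih =>
    refine ((key t ih).biUnion fun c' _ => finite_setOf_forgetStep K ε i t c').subset ?_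
    rintro c ⟨c', h, h'⟩
    exact Set.mem_biUnion h h'
  | join t₁ t₂ ih₁ ih₂ =>
    refine ((key t₁ ih₁).biUnion fun c₁ _ => (key t₂ ih₂).biUnion fun c₂ _ =>
      finite_setOf_joinStep K t₁ t₂ c₁ c₂).subset ?_
    rintro c ⟨c₁, h₁, c₂, h₂, h⟩
    exact Set.mem_biUnion h₁ (Set.mem_biUnion h₂ h)

lemma exists_mem_table {t : NiceTree n} {c : Candidate n m} (hc : c ∈ generated K ε k t) :
    ∃ c' ∈ table K ε k t, c'.strat = c.strat ∧ c'.pay = c.pay ∧ c.val ≤ c'.val := by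
  rw [table_eq_keepBest_generated]
  exact exists_mem_keepBest (finite_generated K ε k t) hc

lemma exists_unrolls {t : NiceTree n} {c : Candidate n m} (hc : c ∈ table K ε k t) :
    ∃ s, Unrolls K ε k t c s := by
  induction t generalizing c with
  | start X => exact ⟨0, rfl⟩
  | introduce i t ih =>
    obtain ⟨c', hc', h⟩ := mem_generated_of_mem_table hc
    obtain ⟨s, hs⟩ := ih hc'
    exact ⟨s, c', hc', h, hs⟩
  | forget i t ih =>
    obtain ⟨c', hc', h⟩ := mem_generated_of_mem_table hc
    obtain ⟨s, hs⟩ := ih hc'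
    exact ⟨_, c', hc', h, s, hs, rfl⟩
  | join t₁ t₂ ih₁ ih₂ =>
    obtain ⟨c₁, hc₁, c₂, hc₂, h⟩ := mem_generated_of_mem_table hc
    obtain ⟨s₁, hs₁⟩ := ih₁ hc₁
    obtain ⟨s₂, hs₂⟩ := ih₂ hc₂
    exact ⟨_, c₁, hc₁, c₂, hc₂, h, s₁, s₂, hs₁, hs₂, rfl⟩

/-- Entries are functions on all players, so agreement on the bag is equality only because of these
default values. This matters at join nodes, and at the empty root bag, where it makes all entries
compete with each other. -/
lemma strat_eq_zero_and_pay_eq_zero {H : SimpleGraph (Fin n)} {t : NiceTree n}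
    (ht : t.Coherent H) {c : Candidate n m} (hc : c ∈ table K ε k t) {j : Fin n}
    (hj : j ∉ t.bag) : c.strat j = 0 ∧ c.pay j = 0 := by
  induction t generalizing c with
  | start X =>
    obtain ⟨h₁, h₂, -⟩ := mem_generated_of_mem_table hc
    have := h₁ j
    rw [if_neg (show j ∉ X from hj)] at this
    exact ⟨this, by rw [h₂]; rfl⟩
  | introduce i t ih =>
    obtain ⟨c', hc', σ, -, h₁, h₂, -⟩ := mem_generated_of_mem_table hc
    obtain ⟨hji, hjt⟩ := not_or.1 (Finset.mem_insert.not.1 hj)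
    rw [h₁, h₂, Function.update_of_ne hji, Function.update_of_ne hji]
    exact ih ht.2 hc' hjt
  | forget i t ih =>
    obtain ⟨c', hc', -, h₁, h₂, -⟩ := mem_generated_of_mem_table hc
    refine ⟨?_, by rw [h₂]; exact funext fun l => if_neg hj⟩
    rw [h₁]
    by_cases hji : j = i
    · rw [hji, Function.update_self]
    · rw [Function.update_of_ne hji]
      exact (ih ht.2.2 hc' fun h => hj (Finset.mem_erase.2 ⟨hji, h⟩)).1
  | join t₁ t₂ ih₁ ih₂ =>
    obtain ⟨c₁, hc₁, c₂, hc₂, -, h₁, h₂, -⟩ := mem_generated_of_mem_table hc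
    obtain ⟨e₁, e₂⟩ := ih₁ ht.2.2.1 hc₁ hj
    obtain ⟨-, e₃⟩ := ih₂ ht.2.2.2 hc₂ (ht.1 ▸ hj)
    exact ⟨by rw [h₁, e₁], by rw [h₂, Pi.add_apply, e₂, e₃, add_zero]⟩

lemma isKUniform_strat {t : NiceTree n} {c : Candidate n m} (hc : c ∈ table K ε k t) {j : Fin n}
    (hj : j ∈ t.bag) : IsKUniform k (c.strat j) := by
  induction t generalizing c with
  | start X =>
    obtain ⟨h₁, -⟩ := mem_generated_of_mem_table hc
    have := h₁ j
    rwa [if_pos (show j ∈ X from hj)] at this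
  | introduce i t ih =>
    obtain ⟨c', hc', σ, hσ, h₁, -⟩ := mem_generated_of_mem_table hc
    rw [h₁]
    by_cases hji : j = i
    · rwa [hji, Function.update_self]
    · rw [Function.update_of_ne hji]
      exact ih hc' ((Finset.mem_insert.1 hj).resolve_left hji)
  | forget i t ih =>
    obtain ⟨c', hc', -, h₁, -⟩ := mem_generated_of_mem_table hc
    obtain ⟨hji, hjt⟩ := Finset.mem_erase.1 hj
    rw [h₁, Function.update_of_ne hji]
    exact ih hc' hjt
  | join t₁ t₂ ih₁ ih₂ =>
    obtain ⟨c₁, hc₁, c₂, hc₂, -, h₁, -⟩ := mem_generated_of_mem_table hc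
    rw [h₁]
    exact ih₁ hc₁ hj

lemma isKUniform_unrolls {t : NiceTree n} (ht : t.Coherent G.graph) {c : Candidate n m}
    {s : Assignment n m} (hs : Unrolls K ε k t c s) {j : Fin n} (hj : j ∈ t.forgotten) :
    IsKUniform k (s j) := by
  induction t generalizing c s with
  | start X => simp [NiceTree.forgotten_start] at hj
  | introduce i t ih =>
    obtain ⟨c', -, -, hs⟩ := hs
    rw [NiceTree.forgotten_introduce ht.1] at hj
    exact ih ht.2 hs hj
  | forget i t ih =>
    obtain ⟨c', hc', -, s', hs', rfl⟩ := hs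
    rw [NiceTree.forgotten_forget (ht.2.2.bag_subset_players ht.1)] at hj
    by_cases hji : j = i
    · rw [hji, Function.update_self]
      exact isKUniform_strat hc' ht.1
    · rw [Function.update_of_ne hji]
      exact ih ht.2.2 hs' ((Finset.mem_insert.1 hj).resolve_left hji)
  | join t₁ t₂ ih₁ ih₂ =>
    obtain ⟨c₁, -, c₂, -, -, s₁, s₂, hs₁, hs₂, rfl⟩ := hs
    rw [NiceTree.forgotten_join ht.1, Finset.mem_union] at hj
    by_cases hj₁ : j ∈ t₁.forgotten
    · simp only [if_pos hj₁]
      exact ih₁ ht.2.2.1 hs₁ hj₁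
    · simp only [if_neg hj₁]
      exact ih₂ ht.2.2.2 hs₂ (hj.resolve_left hj₁)

lemma mem_forgotten_or_mem_bag_of_forget {t : NiceTree n} {i : Fin n}
    (ht : (NiceTree.forget i t).Coherent G.graph) {j : Fin n} (hij : G.graph.Adj i j) :
    j ∈ t.forgotten ∨ j ∈ t.bag := by
  have h₁ := ht.2.1 i (by
    rw [NiceTree.forgotten_forget (ht.2.2.bag_subset_players ht.1)]
    exact Finset.mem_insert_self _ _) j hij
  by_cases h₂ : j ∈ t.bag
  · exact Or.inr h₂
  · exact Or.inl (Finset.mem_sdiff.2 ⟨h₁, h₂⟩)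

/-- When `i` is forgotten, its neighbours outside the forgotten set lie in the bag, so the entry
knows all strategies that `add` reads. -/
lemma localPart_eq_of_coherent {t : NiceTree n} {i : Fin n}
    (ht : (NiceTree.forget i t).Coherent G.graph) {s s' : Assignment n m}
    (h : ∀ j ∈ t.bag, s' j = s j) :
    G.localPart t.forgotten i s' = G.localPart t.forgotten i s := by
  classical
  funext j
  unfold PolymatrixGame.localPart
  split_ifs with hj
  · refine h j ?_
    rcases hj with rfl | ⟨hij, hj⟩
    · exact ht.1
    · exact (mem_forgotten_or_mem_bag_of_forget ht hij).resolve_left hj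
  · rfl

lemma not_adj_of_introduce {t : NiceTree n} {i : Fin n}
    (ht : (NiceTree.introduce i t).Coherent G.graph) :
    ∀ j ∈ t.forgotten, ¬ G.graph.Adj i j := fun _ hj hij =>
  ht.1 (ht.2.mem_players_of_adj hj hij.symm)

lemma notMem_forgotten {t : NiceTree n} {i : Fin n} (hi : i ∈ t.bag) : i ∉ t.forgotten :=
  fun h => (Finset.mem_sdiff.1 h).2 hi

/-! ### Soundness and completeness of the dynamic program -/

/-- One global profile `s` extends both the entry and its unrolling, so the two children of a join
are compared with the same `s`. The value is tracked without error, since `add` and `merge` receive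
exact inputs; only payoffs are rounded. -/
lemma table_sound (hε : 0 < ε) {t : NiceTree n} (ht : t.Coherent G.graph) {c : Candidate n m}
    (hc : c ∈ table K ε k t) {s₀ : Assignment n m} (hu : Unrolls K ε k t c s₀)
    {s : Assignment n m} (hs : IsProfile s) (hbag : ∀ j ∈ t.bag, c.strat j = s j)
    (hfor : ∀ j ∈ t.forgotten, s₀ j = s j) :
    ApproxPay G ε t.forgotten t.bag s c.pay ∧ c.val = K.value t.forgotten s ∧
      ∀ j ∈ t.forgotten, ∀ l, G.purePayoff s j l - 3 / 2 * ε ≤ G.expectedPayoff s j := by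
  induction t generalizing c s₀ with
  | start X =>
    obtain ⟨-, h₂, h₃⟩ := mem_generated_of_mem_table hc
    rw [NiceTree.forgotten_start]
    refine ⟨fun j _ l => ?_, by rw [h₃, K.value_empty s hs], by simp⟩
    rw [h₂, G.payoffFrom_eq_zero (by simp)]
    simp
  | introduce i t ih =>
    obtain ⟨c', hc', ⟨σ, -, h₁, h₂, h₃⟩, hu⟩ := hu
    rw [NiceTree.forgotten_introduce ht.1] at hfor ⊢
    have hi : ∀ j ∈ t.bag, j ≠ i := fun j hj hji =>
      ht.1 (hji ▸ ht.2.bag_subset_players hj)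
    obtain ⟨e₁, e₂, e₃⟩ := ih ht.2 hc' hu (fun j hj => by
      rw [← hbag j (Finset.mem_insert_of_mem hj), h₁, Function.update_of_ne (hi j hj)]) hfor
    rw [h₂, h₃]
    exact ⟨e₁.introduce hε (not_adj_of_introduce ht), e₂, e₃⟩
  | forget i t ih =>
    obtain ⟨c', hc', ⟨h₀, h₁, h₂, h₃⟩, s', hu, rfl⟩ := hu
    have hiF := notMem_forgotten ht.1
    rw [NiceTree.forgotten_forget (ht.2.2.bag_subset_players ht.1)] at hfor ⊢
    have hsi : c'.strat i = s i := by
      rw [← hfor i (Finset.mem_insert_self _ _), Function.update_self]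
    have hbag' : ∀ j ∈ t.bag, c'.strat j = s j := by
      intro j hj
      by_cases hji : j = i
      · rw [hji, hsi]
      · rw [← hbag j (Finset.mem_erase.2 ⟨hji, hj⟩), h₁, Function.update_of_ne hji]
    obtain ⟨e₁, e₂, e₃⟩ := ih ht.2.2 hc' hu hbag' (fun j hj => by
      rw [← hfor j (Finset.mem_insert_of_mem hj),
        Function.update_of_ne fun h : j = i => hiF (h ▸ hj)])
    refine ⟨?_, ?_, fun j hj => ?_⟩
    · rw [h₂]
      exact e₁.forget hε hiF hsi
    · rw [h₃, localPart_eq_of_coherent ht hbag', e₂, K.value_add _ _ _ hs hiF]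
    · rcases Finset.mem_insert.1 hj with rfl | hj
      · intro l
        have hheld := abs_heldPayoff_sub_le hε e₁ ht.1 t.disjoint_forgotten_bag
          (fun _ => mem_forgotten_or_mem_bag_of_forget ht) hbag'
        have h₄ := abs_le.1 (hheld l)
        have h₅ := abs_le.1 (abs_dotProduct_sub_le (hs j) hheld)
        have h₆ := h₀ l
        rw [hsi] at h₆
        unfold PolymatrixGame.expectedPayoff
        -- The test allows `ε`; the best response and the expected payoff are each off by at most `ε
        -- / 4`.
        linarith [h₄.1, h₅.2]
      · exact e₃ j hj
  | join t₁ t₂ ih₁ ih₂ =>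
    obtain ⟨c₁, hc₁, c₂, hc₂, ⟨h₀, h₁, h₂, h₃⟩, s₁, s₂, hu₁, hu₂, rfl⟩ := hu
    have hdisj := NiceTree.disjoint_forgotten ht.2.1
    rw [NiceTree.forgotten_join ht.1] at hfor ⊢
    obtain ⟨e₁, e₂, e₃⟩ := ih₁ ht.2.2.1 hc₁ hu₁ (fun j hj => by rw [← hbag j hj, h₁])
      (fun j hj => (if_pos hj).symm.trans (hfor j (Finset.mem_union_left _ hj)))
    obtain ⟨f₁, f₂, f₃⟩ := ih₂ ht.2.2.2 hc₂ hu₂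
      (fun j hj => by rw [← hbag j (ht.1 ▸ hj : j ∈ t₁.bag), h₁, h₀])
      (fun j hj => (if_neg (Finset.disjoint_right.1 hdisj hj)).symm.trans
        (hfor j (Finset.mem_union_right _ hj)))
    rw [← ht.1] at f₁
    refine ⟨?_, ?_, fun j hj => ?_⟩
    · rw [h₂]
      exact e₁.join f₁ hdisj
    · rw [h₃, e₂, f₂, K.value_merge _ _ s hs hdisj fun i hi j hj => ht.not_adj_join hi hj]
    · exact (Finset.mem_union.1 hj).elim (e₃ j) (f₃ j)

open Classical in
/-- The value of an entry is the value of a profile that extends the strategies of the entry. -/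
lemma exists_profile_value_eq (hε : 0 < ε) (hk : 0 < k) {t : NiceTree n}
    (ht : t.Coherent G.graph) {c : Candidate n m} (hc : c ∈ table K ε k t) {s : Assignment n m}
    (hs : IsProfile s) (hbag : ∀ j ∈ t.bag, c.strat j = s j) :
    ∃ s₁, IsProfile s₁ ∧ (∀ j ∉ t.forgotten, s₁ j = s j) ∧ c.val = K.value t.forgotten s₁ := by
  obtain ⟨s₀, hu⟩ := exists_unrolls hc
  have hs₁ : IsProfile fun j => if j ∈ t.forgotten then s₀ j else s j := by
    intro j
    by_cases hj : j ∈ t.forgotten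
    · simp only [if_pos hj]
      exact (isKUniform_unrolls ht hu hj).mem_stdSimplex hk
    · simp only [if_neg hj]
      exact hs j
  refine ⟨_, hs₁, fun j hj => if_neg hj, (table_sound hε ht hc hu hs₁ (fun j hj => ?_)
    fun j hj => (if_pos hj).symm).2.1⟩
  rw [if_neg (notMem_forgotten hj), hbag j hj]

/-- The entry found may stem from other strategies of the forgotten players than those of `s`. It
only has to match `s` on the bag, approximate the payoffs under `s`, and have at least its value;
these three properties suffice to continue the induction. -/
lemma table_complete (hε : 0 < ε) (hk : 0 < k) {c : Fin n → ℝ} {d : Fin n → Fin m → ℝ}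
    (hK : K.IsLinear c d) {s : Assignment n m} (hsk : ∀ i, IsKUniform k (s i))
    (hNE : G.IsApproxNE (ε / 2) s) {t : NiceTree n} (ht : t.Coherent G.graph) :
    ∃ e ∈ table K ε k t, (∀ j ∈ t.bag, e.strat j = s j) ∧
      ApproxPay G ε t.forgotten t.bag s e.pay ∧ K.value t.forgotten s ≤ e.val := by
  classical
  have hs := hNE.1
  -- `keepBest` may replace an entry by one with the same strategies and payoffs and a larger value,
  -- which preserves all three properties.
  have lift : ∀ t, (∃ e ∈ generated K ε k t, (∀ j ∈ t.bag, e.strat j = s j) ∧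
      ApproxPay G ε t.forgotten t.bag s e.pay ∧ K.value t.forgotten s ≤ e.val) →
      ∃ e ∈ table K ε k t, (∀ j ∈ t.bag, e.strat j = s j) ∧
      ApproxPay G ε t.forgotten t.bag s e.pay ∧ K.value t.forgotten s ≤ e.val := by
    rintro t ⟨e, he, h₁, h₂, h₃⟩
    obtain ⟨e', he', h₄, h₅, h₆⟩ := exists_mem_table he
    exact ⟨e', he', by rwa [h₄], by rwa [h₅], h₃.trans h₆⟩
  refine lift t ?_
  induction t with
  | start X =>
    rw [NiceTree.forgotten_start]
    refine ⟨⟨fun i => if i ∈ X then s i else 0, 0, K.emptyValue⟩, ⟨fun i => ?_, rfl, rfl⟩,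
      fun j hj => if_pos hj, fun j _ l => ?_, (K.value_empty s hs).le⟩
    · by_cases hi : i ∈ X
      · simpa only [if_pos hi] using hsk i
      · simp only [if_neg hi]
    · rw [G.payoffFrom_eq_zero (by simp)]
      simp
  | introduce i t ih =>
    obtain ⟨e, he, h₁, h₂, h₃⟩ := lift t (ih ht.2)
    rw [NiceTree.forgotten_introduce ht.1]
    refine ⟨⟨Function.update e.strat i (s i), Function.update e.pay i 0, e.val⟩,
      ⟨e, he, s i, hsk i, rfl, rfl, rfl⟩, fun j hj => ?_,
      h₂.introduce hε (not_adj_of_introduce ht), h₃⟩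
    by_cases hji : j = i
    · subst hji
      exact Function.update_self ..
    · exact (Function.update_of_ne hji ..).trans
        (h₁ j ((Finset.mem_insert.1 hj).resolve_left hji))
  | forget i t ih =>
    obtain ⟨e, he, h₁, h₂, h₃⟩ := lift t (ih ht.2.2)
    have hiF := notMem_forgotten ht.1
    rw [NiceTree.forgotten_forget (ht.2.2.bag_subset_players ht.1)]
    refine ⟨⟨_, _, _⟩, ⟨e, he, fun l => ?_, rfl, rfl, rfl⟩, fun j hj => ?_,
      h₂.forget hε hiF (h₁ i ht.1), ?_⟩
    · have hheld := abs_heldPayoff_sub_le hε h₂ ht.1 t.disjoint_forgotten_bag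
        (fun _ => mem_forgotten_or_mem_bag_of_forget ht) h₁
      have h₄ := abs_le.1 (hheld l)
      have h₅ := abs_le.1 (abs_dotProduct_sub_le (hs i) hheld)
      have h₆ := hNE.2 i l
      unfold PolymatrixGame.expectedPayoff at h₆
      rw [h₁ i ht.1]
      -- Regret `ε / 2` under `s` plus two errors of `ε / 4` stays within the tolerance `ε`.
      linarith [h₄.2, h₅.1]
    · obtain ⟨hji, hjt⟩ := Finset.mem_erase.1 hj
      exact (Function.update_of_ne hji ..).trans (h₁ j hjt)
    -- The behaviour of `add` is known only on values attained by profiles, so the stored number is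
    -- first realised by some `s₁` that agrees with `s` outside the forgotten players.
    · obtain ⟨s₁, hs₁, h₄, h₅⟩ := exists_profile_value_eq hε hk ht.2.2 he hs h₁
      have h₆ : G.localPart t.forgotten i s₁ = G.localPart t.forgotten i s :=
        localPart_eq_of_coherent ht fun j hj => h₄ j (notMem_forgotten hj)
      have h₇ := hK.value_insert_mono hiF hs hs₁ h₆.symm (h₃.trans_eq h₅)
      rw [K.value_add _ _ _ hs₁ hiF, h₆, ← h₅] at h₇
      simpa only [localPart_eq_of_coherent ht h₁] using h₇
  | join t₁ t₂ ih₁ ih₂ =>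
    obtain ⟨e₁, he₁, h₁, h₂, h₃⟩ := lift t₁ (ih₁ ht.2.2.1)
    obtain ⟨e₂, he₂, f₁, f₂, f₃⟩ := lift t₂ (ih₂ ht.2.2.2)
    have hdisj := NiceTree.disjoint_forgotten ht.2.1
    have hadj : ∀ i ∈ t₁.forgotten, ∀ j ∈ t₂.forgotten, ¬ G.graph.Adj i j :=
      fun i hi j hj => ht.not_adj_join hi hj
    rw [NiceTree.forgotten_join ht.1]
    have hstrat : e₁.strat = e₂.strat := by
      funext j
      by_cases hj : j ∈ t₁.bag
      · rw [h₁ j hj, f₁ j (ht.1 ▸ hj)]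
      · rw [(strat_eq_zero_and_pay_eq_zero ht.2.2.1 he₁ hj).1,
          (strat_eq_zero_and_pay_eq_zero ht.2.2.2 he₂ (ht.1 ▸ hj)).1]
    rw [← ht.1] at f₂
    refine ⟨⟨e₁.strat, e₁.pay + e₂.pay, K.merge t₁.forgotten t₂.forgotten e₁.val e₂.val⟩,
      ⟨e₁, he₁, e₂, he₂, hstrat, rfl, rfl, rfl⟩, h₁, h₂.join f₂ hdisj, ?_⟩
    obtain ⟨s₁, hs₁, h₄, h₅⟩ := exists_profile_value_eq hε hk ht.2.2.1 he₁ hs h₁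
    obtain ⟨s₂, hs₂, f₄, f₅⟩ := exists_profile_value_eq hε hk ht.2.2.2 he₂ hs f₁
    -- Both stored numbers must be values of a single profile before `value_merge` applies. Gluing
    -- works because no edge joins the two forgotten sets: outside its own forgotten set, each side
    -- sees only players on whom `s₁` and `s₂` equal `s`.
    have hs₃ : IsProfile fun j => if j ∈ t₁.forgotten then s₁ j else s₂ j := by
      intro j
      by_cases hj : j ∈ t₁.forgotten
      · simp only [if_pos hj, hs₁ j]
      · simp only [if_neg hj, hs₂ j]
    have e₃ : e₁.val = K.value t₁.forgotten fun j => if j ∈ t₁.forgotten then s₁ j else s₂ j := by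
      rw [h₅]
      refine hK.value_congr hs₁ hs₃ fun j hj => ?_
      by_cases hj' : j ∈ t₁.forgotten
      · rw [if_pos hj']
      · rw [if_neg hj', h₄ j hj', f₄ j]
        obtain ⟨i, hi, hij⟩ := hj.resolve_left hj'
        exact fun h => hadj i hi j h hij
    have e₄ : e₂.val = K.value t₂.forgotten fun j => if j ∈ t₁.forgotten then s₁ j else s₂ j := by
      rw [f₅]
      refine hK.value_congr hs₂ hs₃ fun j hj => ?_
      have hj' : j ∉ t₁.forgotten := by
        intro h
        rcases hj with hj | ⟨i, hi, hij⟩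
        · exact Finset.disjoint_left.1 hdisj h hj
        · exact hadj j h i hi hij.symm
      rw [if_neg hj']
    have h₆ := K.value_merge _ _ _ hs₃ hdisj hadj
    rw [hK.value_union hs₃ hdisj hadj, ← e₃, ← e₄] at h₆
    rw [hK.value_union hs hdisj hadj, ← h₆]
    exact add_le_add h₃ f₃

end ConstrainedAlgorithm
end

/-! ### Sampling and Hoeffding's inequality -/

noncomputable section

open MeasureTheory ProbabilityTheory in
/-- **Hoeffding's inequality** for the mean of `k` independent samples. -/
lemma measureReal_abs_mean_sub_integral_ge_le {X : Type*} [MeasurableSpace X] (ν : Measure X)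
    [IsProbabilityMeasure ν] {f : X → ℝ} (hf : Measurable f) (h01 : ∀ x, f x ∈ Set.Icc (0 : ℝ) 1)
    {k : ℕ} (hk : 0 < k) {δ : ℝ} (hδ : 0 ≤ δ) :
    (Measure.pi fun _ : Fin k => ν).real
      {ω | δ ≤ |(∑ t, f (ω t)) / k - ∫ x, f x ∂ν|} ≤ 2 * Real.exp (-(2 * k * δ ^ 2)) := by
  have hk' : (0 : ℝ) < k := by exact_mod_cast hk
  set μ := Measure.pi fun _ : Fin k => ν
  set Y : Fin k → (Fin k → X) → ℝ := fun t ω => f (ω t) - ∫ x, f x ∂ν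
  have hind : iIndepFun Y μ :=
    iIndepFun_pi (X := fun _ x => f x - ∫ x, f x ∂ν) fun _ => (hf.sub_const _).aemeasurable
  have hsub : ∀ t, HasSubgaussianMGF (Y t) ((‖(1 : ℝ) - 0‖₊ / 2) ^ 2) μ := by
    intro t
    have h := hasSubgaussianMGF_of_mem_Icc (μ := μ) (X := fun ω => f (ω t))
      (hf.comp (measurable_pi_apply t)).aemeasurable (Filter.Eventually.of_forall fun ω => h01 _)
    rwa [integral_comp_eval (μ := fun _ : Fin k => ν) (i := t) hf.aestronglyMeasurable] at h
  have hsub' : ∀ t, HasSubgaussianMGF (-Y t) ((‖(1 : ℝ) - 0‖₊ / 2) ^ 2) μ := fun t => (hsub t).neg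
  have hind' : iIndepFun (fun t => -Y t) μ :=
    hind.comp (fun _ x => -x) fun _ => measurable_neg
  -- Each sample has variance proxy `1 / 4`, which sums to `k / 4`.
  have hexp : -(k * δ) ^ 2 / (2 * ((∑ _t : Fin k, (‖(1 : ℝ) - 0‖₊ / 2) ^ 2 : NNReal) : ℝ)) =
      -(2 * k * δ ^ 2) := by
    simp
    field_simp
  have h₁ := HasSubgaussianMGF.measure_sum_ge_le_of_iIndepFun hind (s := Finset.univ) (fun t _ => hsub t)
    (ε := k * δ) (by positivity)
  have h₂ := HasSubgaussianMGF.measure_sum_ge_le_of_iIndepFun hind' (s := Finset.univ) (fun t _ => hsub' t)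
    (ε := k * δ) (by positivity)
  rw [hexp] at h₁ h₂
  have hsum : ∀ ω : Fin k → X,
      ∑ t, Y t ω = k * ((∑ t, f (ω t)) / k - ∫ x, f x ∂ν) := fun ω => by
    simp only [Y, Finset.sum_sub_distrib, Finset.sum_const, Finset.card_univ, Fintype.card_fin,
      nsmul_eq_mul]
    field_simp
  calc μ.real {ω | δ ≤ |(∑ t, f (ω t)) / k - ∫ x, f x ∂ν|}
      ≤ μ.real ({ω | k * δ ≤ ∑ t, Y t ω} ∪ {ω | k * δ ≤ ∑ t, (-Y t) ω}) := by
        refine measureReal_mono (fun ω hω => ?_)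
        rcases le_abs.1 (show δ ≤ |_| from hω) with h | h
        · left
          rw [Set.mem_ofPred_eq, hsum]
          exact mul_le_mul_of_nonneg_left h hk'.le
        · right
          rw [Set.mem_ofPred_eq]
          simp only [Pi.neg_apply, Finset.sum_neg_distrib]
          rw [hsum, ← mul_neg]
          exact mul_le_mul_of_nonneg_left h hk'.le
    _ ≤ _ := measureReal_union_le _ _
    _ ≤ _ := by linarith

open MeasureTheory in
/-- If `k` is large, then some `k` samples have means close to the expectation for finitely many
functions simultaneously. -/
lemma exists_sample {X ι : Type*} [MeasurableSpace X] [Fintype ι] (ν : Measure X)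
    [IsProbabilityMeasure ν] {f : ι → X → ℝ} (hf : ∀ a, Measurable (f a))
    (h01 : ∀ a x, f a x ∈ Set.Icc (0 : ℝ) 1) {k : ℕ} (hk : 0 < k) {δ : ℝ} (hδ : 0 ≤ δ)
    (hcard : Fintype.card ι * (2 * Real.exp (-(2 * k * δ ^ 2))) < 1) :
    ∃ ω : Fin k → X, ∀ a, |(∑ t, f a (ω t)) / k - ∫ x, f a x ∂ν| ≤ δ := by
  -- Otherwise the bad events cover the whole space, contradicting the union bound.
  by_contra! hcon
  have h₁ : (Measure.pi fun _ : Fin k => ν).real Set.univ ≤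
      ∑ a, (Measure.pi fun _ : Fin k => ν).real
        {ω | δ ≤ |(∑ t, f a (ω t)) / k - ∫ x, f a x ∂ν|} := by
    refine (measureReal_mono fun ω _ => ?_).trans (measureReal_iUnion_fintype_le _)
    obtain ⟨a, ha⟩ := hcon ω
    exact Set.mem_iUnion.2 ⟨a, ha.le⟩
  have h₂ := h₁.trans (Finset.sum_le_sum fun a _ =>
    measureReal_abs_mean_sub_integral_ge_le ν (hf a) (h01 a) hk hδ)
  simp only [probReal_univ, Finset.sum_const, Finset.card_univ, nsmul_eq_mul] at h₂
  linarith

/-- The empirical distribution of a list of `k` pure strategies. -/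
def empirical {m k : ℕ} (ω : Fin k → Fin m) (l : Fin m) : ℝ :=
  ((Finset.univ.val.map ω).count l : ℝ) / k

lemma isKUniform_empirical {m k : ℕ} (ω : Fin k → Fin m) : IsKUniform k (empirical ω) :=
  ⟨Finset.univ.val.map ω, by simp, fun _ => rfl⟩

lemma sum_empirical_mul {m k : ℕ} (ω : Fin k → Fin m) (g : Fin m → ℝ) :
    ∑ l, empirical ω l * g l = (∑ t, g (ω t)) / k := by
  have h : ∑ t, g (ω t) = ∑ l, ((Finset.univ.val.map ω).count l : ℝ) * g l := by
    have := Finset.sum_multiset_map_count (Finset.univ.val.map ω) g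
    rw [Multiset.map_map] at this
    refine (show ∑ t, g (ω t) = _ from this).trans ?_
    simp_rw [nsmul_eq_mul]
    refine Finset.sum_subset (Finset.subset_univ _) fun l _ hl => ?_
    rw [Multiset.mem_toFinset] at hl
    rw [Multiset.count_eq_zero_of_notMem hl]
    simp
  rw [h, Finset.sum_div]
  exact Finset.sum_congr rfl fun l _ => div_mul_eq_mul_div _ _ _

lemma isKUniform_single {m k : ℕ} (a : Fin m) (hk : 0 < k) :
    IsKUniform k (Pi.single a 1 : Fin m → ℝ) := by
  refine ⟨Multiset.replicate k a, Multiset.card_replicate k a, fun l => ?_⟩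
  have : (k : ℝ) ≠ 0 := by positivity
  by_cases h : l = a
  · subst h
    simp [this]
  · rw [Pi.single_eq_of_ne h, Multiset.count_replicate, if_neg (Ne.symm h)]
    simp

open MeasureTheory in
/-- A mixed strategy as a probability measure. -/
lemma exists_measure_of_mem_stdSimplex {m : ℕ} {σ : Fin m → ℝ} (hσ : σ ∈ stdSimplex ℝ (Fin m)) :
    ∃ ν : Measure (Fin m), IsProbabilityMeasure ν ∧
      ∀ g : Fin m → ℝ, ∫ a, g a ∂ν = ∑ a, σ a * g a := by
  have h : ∑ a, ENNReal.ofReal (σ a) = 1 := by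
    rw [← ENNReal.ofReal_sum_of_nonneg fun a _ => hσ.1 a, hσ.2, ENNReal.ofReal_one]
  refine ⟨(PMF.ofFintype _ h).toMeasure, inferInstance, fun g => ?_⟩
  rw [PMF.integral_eq_sum]
  refine Finset.sum_congr rfl fun a _ => ?_
  rw [PMF.ofFintype_apply, ENNReal.toReal_ofReal (hσ.1 a), smul_eq_mul]

/-! ### Approximation by `k`-uniform profiles -/

namespace PolymatrixGame

variable {n m : ℕ} {G : PolymatrixGame n m}

open Classical in
lemma purePayoff_apply (G : PolymatrixGame n m) (s : Assignment n m) (i : Fin n) (l : Fin m) :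
    G.purePayoff s i l =
      ∑ j with G.graph.Adj i j, ∑ a, s j a * G.payoff i j l a := by
  unfold purePayoff payoffFrom
  rw [Finset.sum_apply]
  refine Finset.sum_congr rfl fun j _ => ?_
  simp only [Matrix.mulVec, dotProduct, mul_comm]

lemma IsNormalised.expectedPayoff_mem (hG : G.IsNormalised) {s : Assignment n m}
    (hs : IsProfile s) (i : Fin n) : 0 ≤ G.expectedPayoff s i ∧ G.expectedPayoff s i ≤ 1 := by
  unfold expectedPayoff dotProduct
  constructor
  · exact Finset.sum_nonneg fun l _ => mul_nonneg ((hs i).1 l) (hG s hs i l).1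
  · calc ∑ l, s i l * G.purePayoff s i l ≤ ∑ l, s i l := Finset.sum_le_sum fun l _ =>
          mul_le_of_le_one_right ((hs i).1 l) (hG s hs i l).2
      _ = 1 := (hs i).2

-- Each sample is a whole pure profile. Normalisation bounds only the total payoff of a player, so
-- Hoeffding is applied to the sum over all neighbours rather than edge by edge. Expected payoffs
-- are not linear in the sampled profile; the last estimate therefore freezes the opponents at `s`.
open MeasureTheory in
lemma exists_isKUniform_close_of_card_mul_exp_lt (hG : G.IsNormalised) {s : Assignment n m}
    (hs : IsProfile s) {k : ℕ} (hk : 0 < k) {δ : ℝ} (hδ : 0 ≤ δ)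
    (hcard : (n * (m + 1) : ℝ) * (2 * Real.exp (-(2 * k * δ ^ 2))) < 1) :
    ∃ s₁ : Assignment n m, (∀ i, IsKUniform k (s₁ i)) ∧
      (∀ i l, |G.purePayoff s₁ i l - G.purePayoff s i l| ≤ δ) ∧
      ∀ i, |dotProduct (s₁ i) (G.purePayoff s i) - G.expectedPayoff s i| ≤ δ := by
  classical
  choose ν hν hint using fun i => exists_measure_of_mem_stdSimplex (hs i)
  -- `none`: the sampled strategy of `i` against the original `s`; `some l`: pure strategy `l`
  -- against the sampled opponents. This gives `n (m + 1)` test functions.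
  let f : Fin n × Option (Fin m) → (Fin n → Fin m) → ℝ := fun
    | (i, none), x => G.purePayoff s i (x i)
    | (i, some l), x => ∑ j with G.graph.Adj i j, G.payoff i j l (x j)
  have hpure : ∀ i l (x : Fin n → Fin m),
      G.purePayoff (fun j => Pi.single (x j) 1) i l =
        ∑ j with G.graph.Adj i j, G.payoff i j l (x j) := fun i l x => by
    rw [purePayoff_apply]
    refine Finset.sum_congr rfl fun j _ => ?_
    simp [Pi.single_apply]
  have h01 : ∀ a x, f a x ∈ Set.Icc (0 : ℝ) 1 := by
    rintro ⟨i, _ | l⟩ x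
    · exact hG s hs i (x i)
    · have := hG (fun j => Pi.single (x j) 1) (fun j => single_mem_stdSimplex ℝ (x j)) i l
      rw [hpure] at this
      exact this
  obtain ⟨ω, hω⟩ := exists_sample (Measure.pi ν) (f := f) (fun a => measurable_of_finite _) h01 hk
    hδ (by simpa [Fintype.card_prod, Fintype.card_option] using hcard)
  refine ⟨fun j => empirical fun t => ω t j, fun j => isKUniform_empirical _, fun i l => ?_,
    fun i => ?_⟩
  · have h₁ : G.purePayoff (fun j => empirical fun t => ω t j) i l =
        (∑ t, f (i, some l) (ω t)) / k := by
      rw [purePayoff_apply]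
      simp_rw [sum_empirical_mul]
      rw [← Finset.sum_div, Finset.sum_comm]
    have h₂ : G.purePayoff s i l = ∫ x, f (i, some l) x ∂Measure.pi ν := by
      rw [purePayoff_apply, integral_finsetSum _ fun j _ => Integrable.of_finite]
      refine Finset.sum_congr rfl fun j _ => ?_
      rw [integral_comp_eval (μ := ν) (i := j) (f := fun a => G.payoff i j l a)
        (measurable_of_finite _).aestronglyMeasurable, hint]
    rw [h₁, h₂]
    exact hω (i, some l)
  · have h₁ : dotProduct (empirical fun t => ω t i) (G.purePayoff s i) =
        (∑ t, f (i, none) (ω t)) / k := sum_empirical_mul _ _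
    have h₂ : G.expectedPayoff s i = ∫ x, f (i, none) x ∂Measure.pi ν := by
      rw [integral_comp_eval (μ := ν) (i := i) (f := fun a => G.purePayoff s i a)
        (measurable_of_finite _).aestronglyMeasurable, hint]
      rfl
    rw [h₁, h₂]
    exact hω (i, none)

/-- With `y = 8mn / ε` the bound on `k` says `2k (ε/8)² ≥ 4 log y`, so the exponential is at most
`y⁻⁴`. The prefactor is at most `4y`, and `4y < y⁴` because `y ≥ mn ≥ 2`. -/
lemma card_mul_exp_lt_one {n m k : ℕ} (hn : 0 < n) (hm : 2 ≤ m) {ε : ℝ} (hε : 0 < ε) (hε8 : ε < 8)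
    (hk : 128 * (Real.log m + Real.log n - Real.log ε + Real.log 8) / ε ^ 2 ≤ k) :
    (n * (m + 1) : ℝ) * (2 * Real.exp (-(2 * k * (ε / 8) ^ 2))) < 1 := by
  have hn' : (1 : ℝ) ≤ n := by exact_mod_cast hn
  have hm' : (2 : ℝ) ≤ m := by exact_mod_cast hm
  set y : ℝ := m * n / ε * 8 with hy
  have hy0 : 0 < y := by positivity
  have hlog : Real.log m + Real.log n - Real.log ε + Real.log 8 = Real.log y := by
    rw [hy, Real.log_mul (by positivity) (by norm_num), Real.log_div (by positivity) hε.ne',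
      Real.log_mul (by positivity) (by positivity)]
  rw [hlog, div_le_iff₀ (by positivity)] at hk
  have hmn : (m * n : ℝ) ≤ y := by
    rw [hy, div_mul_eq_mul_div, le_div_iff₀ hε]
    exact mul_le_mul_of_nonneg_left hε8.le (by positivity)
  have hmn2 : (2 : ℝ) ≤ m * n := by nlinarith
  have h₁ : Real.exp (-(2 * k * (ε / 8) ^ 2)) ≤ (y ^ 4)⁻¹ := by
    rw [Real.exp_neg]
    refine inv_anti₀ (by positivity) ?_
    rw [← Real.exp_log (show 0 < y ^ 4 by positivity), Real.log_pow]
    refine Real.exp_le_exp.2 ?_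
    push_cast
    nlinarith
  have h₂ : (n * (m + 1) : ℝ) * 2 ≤ 4 * y := by nlinarith
  have h₃ : 4 * y < y ^ 4 := by
    have : (8 : ℝ) ≤ y ^ 3 := by
      calc (8 : ℝ) = 2 ^ 3 := by norm_num
        _ ≤ y ^ 3 := by gcongr; linarith
    nlinarith
  calc (n * (m + 1) : ℝ) * (2 * Real.exp (-(2 * k * (ε / 8) ^ 2)))
      ≤ (n * (m + 1) : ℝ) * (2 * (y ^ 4)⁻¹) := by gcongr
    _ = ((n * (m + 1) : ℝ) * 2) / y ^ 4 := by ring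
    _ < 1 := by
      rw [div_lt_one (by positivity)]
      linarith

/-- Every profile can be replaced by a `k`-uniform one with almost the same payoffs. -/
lemma exists_isKUniform_close (hG : G.IsNormalised) (hm : 0 < m) {s : Assignment n m}
    (hs : IsProfile s) {ε : ℝ} (hε : 0 < ε) {k : ℕ} (hk : 0 < k)
    (hk' : 128 * (Real.log m + Real.log n - Real.log ε + Real.log 8) / ε ^ 2 ≤ k) :
    ∃ s₁ : Assignment n m, (∀ i, IsKUniform k (s₁ i)) ∧
      (∀ i l, |G.purePayoff s₁ i l - G.purePayoff s i l| ≤ ε / 8) ∧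
      ∀ i, |G.expectedPayoff s₁ i - G.expectedPayoff s i| ≤ ε / 4 := by
  have hunif : ∀ i : Fin n, IsKUniform k (Pi.single (⟨0, hm⟩ : Fin m) (1 : ℝ) : Fin m → ℝ) :=
    fun i => isKUniform_single _ hk
  rcases Nat.eq_zero_or_pos n with rfl | hn
  · exact ⟨s, fun i => i.elim0, fun i => i.elim0, fun i => i.elim0⟩
  -- For `ε ≥ 8` the tolerances are at least `1`, and payoffs in `[0, 1]` never differ by more.
  rcases le_or_gt 8 ε with hε8 | hε8
  · have hs₁ : IsProfile fun _ : Fin n => (Pi.single (⟨0, hm⟩ : Fin m) (1 : ℝ) : Fin m → ℝ) :=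
      fun i => (hunif i).mem_stdSimplex hk
    refine ⟨_, hunif, fun i l => ?_, fun i => ?_⟩
    · obtain ⟨h₁, h₂⟩ := hG _ hs₁ i l
      obtain ⟨h₃, h₄⟩ := hG _ hs i l
      rw [abs_le]
      constructor <;> linarith
    · obtain ⟨h₁, h₂⟩ := hG.expectedPayoff_mem hs₁ i
      obtain ⟨h₃, h₄⟩ := hG.expectedPayoff_mem hs i
      rw [abs_le]
      constructor <;> linarith
  -- With a single pure strategy the profile is already `k`-uniform; the counting estimate needs `mn
  -- ≥ 2`.
  rcases Nat.lt_or_ge m 2 with hm2 | hm2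
  · obtain rfl : m = 1 := by omega
    refine ⟨s, fun i => ?_, fun i l => ?_, fun i => ?_⟩
    · have h₁ : s i = Pi.single 0 1 := by
        funext l
        have h := (hs i).2
        rw [Fin.sum_univ_one] at h
        rw [Subsingleton.elim l 0, h, Pi.single_eq_same]
      rw [h₁]
      exact isKUniform_single _ hk
    · rw [sub_self, abs_zero]
      positivity
    · rw [sub_self, abs_zero]
      positivity
  obtain ⟨s₁, h₁, h₂, h₃⟩ := exists_isKUniform_close_of_card_mul_exp_lt hG hs hk
    (by positivity) (card_mul_exp_lt_one hn hm2 hε hε8 hk')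
  refine ⟨s₁, h₁, h₂, fun i => ?_⟩
  -- The opponents are changed first, then the player's own strategy, at a cost of `ε / 8` each.
  have h₄ := abs_dotProduct_sub_le ((h₁ i).mem_stdSimplex hk) (h₂ i)
  calc |G.expectedPayoff s₁ i - G.expectedPayoff s i| ≤ _ := abs_sub_le _
        (dotProduct (s₁ i) (G.purePayoff s i)) _
    _ ≤ ε / 8 + ε / 8 := add_le_add h₄ (h₃ i)
    _ = ε / 4 := by ring

lemma linearPayoff_ge_of_close (c : Fin n → ℝ) (d : Fin n → Fin m → ℝ) {s s' : Assignment n m}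
    {η : ℝ} (hp : ∀ i l, |G.purePayoff s i l - G.purePayoff s' i l| ≤ η)
    (he : ∀ i, |G.expectedPayoff s i - G.expectedPayoff s' i| ≤ η) :
    G.linearPayoff c d s' - (∑ i, (|c i| + ∑ l, |d i l|)) * η ≤ G.linearPayoff c d s := by
  have key : ∀ a x y : ℝ, |x - y| ≤ η → a * y - |a| * η ≤ a * x := fun a x y h => by
    have h₁ := mul_le_mul_of_nonneg_left h (abs_nonneg a)
    rw [← abs_mul] at h₁
    have h₂ := (abs_le.1 h₁).1
    linarith
  unfold linearPayoff
  rw [Finset.sum_mul, ← Finset.sum_sub_distrib]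
  refine Finset.sum_le_sum fun i _ => ?_
  have h₁ := key (c i) _ _ (he i)
  have h₂ := Finset.sum_le_sum fun l (_ : l ∈ Finset.univ) => key (d i l) _ _ (hp i l)
  rw [Finset.sum_sub_distrib, ← Finset.sum_mul] at h₂
  linarith

end PolymatrixGame
end

/-! ### The main theorem -/

theorem mainTheorem6 :
    (∀ (n m : ℕ) (G : PolymatrixGame n m) (c : Fin n → ℝ) (d : Fin n → Fin m → ℝ),
      ∃ K : OVDConstraint G, K.IsLinear c d) ∧
    ∃ C : ℝ, ∀ (n m : ℕ) (_ : 0 < m) (G : PolymatrixGame n m) (_ : G.IsNormalised)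
      (c : Fin n → ℝ) (d : Fin n → Fin m → ℝ) (K : OVDConstraint G) (_ : K.IsLinear c d)
      (t : NiceTree n) (_ : t.IsNiceTreeDecomposition G.graph) (_ : t.bag = ∅)
      (ε : ℝ) (_ : 0 < ε) (k : ℕ) (_ : 0 < k)
      (_ : 128 * (Real.log m + Real.log n - Real.log ε + Real.log 8) / ε ^ 2 ≤ k),
      (∀ s, ConstrainedAlgorithm.Returns K ε k t s →
        G.IsApproxNE (3 / 2 * ε) s ∧ ∀ i, IsKUniform k (s i)) ∧
      ∀ s', G.IsApproxNE (ε / 8) s' →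
        (∃ s, ConstrainedAlgorithm.Returns K ε k t s) ∧
        ∀ s, ConstrainedAlgorithm.Returns K ε k t s →
          K.value Finset.univ s ≥
            K.value Finset.univ s' - C * (∑ i, (|c i| + ∑ l, |d i l|)) * ε := by
  refine ⟨fun n m G c d => ⟨OVDConstraint.linear G c d, OVDConstraint.linear_isLinear G c d⟩,
    -- `1 / 4` is the sampling error of the expected payoffs in units of `ε`.
    1 / 4, fun n m hm G hG c d K hK t ht hbag ε hε k hk hk' => ?_⟩
  have hcoh := ht.coherent
  have hfor : t.forgotten = Finset.univ := by
    rw [NiceTree.forgotten, ht.players_eq, hbag, Finset.sdiff_empty]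
  have hempty : ∀ j, j ∉ t.bag := fun j => by simp [hbag]
  have hret : ∀ c s, c ∈ ConstrainedAlgorithm.table K ε k t →
      ConstrainedAlgorithm.Unrolls K ε k t c s →
      (∀ i, IsKUniform k (s i)) ∧ G.IsApproxNE (3 / 2 * ε) s ∧
        c.val = K.value Finset.univ s := fun c s hc hu => by
    have hs : ∀ i, IsKUniform k (s i) := fun i =>
      ConstrainedAlgorithm.isKUniform_unrolls hcoh hu (hfor ▸ Finset.mem_univ i)
    have hprof : IsProfile s := fun i => (hs i).mem_stdSimplex hk
    obtain ⟨-, h₁, h₂⟩ := ConstrainedAlgorithm.table_sound hε hcoh hc hu hprof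
      (fun j hj => absurd hj (hempty j)) fun _ _ => rfl
    rw [hfor] at h₁ h₂
    exact ⟨hs, ⟨hprof, fun i => h₂ i (Finset.mem_univ i)⟩, h₁⟩
  refine ⟨fun s ⟨e, he, hu⟩ => ⟨(hret e s he hu).2.1, (hret e s he hu).1⟩, fun s' hs' => ?_⟩
  obtain ⟨s₁, h₁, h₂, h₃⟩ := PolymatrixGame.exists_isKUniform_close hG hm hs'.1 hε hk hk'
  have hs₁ : G.IsApproxNE (ε / 2) s₁ := by
    refine ⟨fun i => (h₁ i).mem_stdSimplex hk, fun i l => ?_⟩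
    have h₄ := abs_le.1 (h₂ i l)
    have h₅ := abs_le.1 (h₃ i)
    linarith [h₄.2, h₅.1, hs'.2 i l]
  obtain ⟨e, he, -, -, hval⟩ := ConstrainedAlgorithm.table_complete hε hk hK h₁ hs₁ hcoh
  rw [hfor] at hval
  obtain ⟨s, hs⟩ := ConstrainedAlgorithm.exists_unrolls he
  refine ⟨⟨s, e, he, hs⟩, fun s₂ ⟨e₂, he₂, hu₂⟩ => ?_⟩
  -- With an empty root bag all strategies and payoff vectors are zero, so every surviving root
  -- entry has the maximal value. This covers every possible output.
  have hle : e.val ≤ e₂.val := by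
    have hzero := fun {e} (he : e ∈ ConstrainedAlgorithm.table K ε k t) (j : Fin n) =>
      ConstrainedAlgorithm.strat_eq_zero_and_pay_eq_zero hcoh he (hempty j)
    have he₂' := he₂
    rw [ConstrainedAlgorithm.table_eq_keepBest_generated] at he₂'
    exact he₂'.2 e (ConstrainedAlgorithm.mem_generated_of_mem_table he)
      (funext fun j => (hzero he j).1.trans (hzero he₂ j).1.symm)
      (funext fun j => (hzero he j).2.trans (hzero he₂ j).2.symm)
  have hlin := PolymatrixGame.linearPayoff_ge_of_close (G := G) c d
    (fun i l => (h₂ i l).trans (by linarith : ε / 8 ≤ ε / 4)) h₃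
  rw [← (hret e₂ s₂ he₂ hu₂).2.2]
  rw [hK _ _ hs₁.1, PolymatrixGame.subgame_univ] at hval
  rw [hK _ _ hs'.1, PolymatrixGame.subgame_univ]
  linarith
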